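/- Let $0<\alpha\le 0.2$ and $n>0$. Let $Y$ be observed from the white noise model $dY(t)=f(t)\,dt+n^{-1/2}\,dW(t)$, $-\tfrac12\le t\le\tfrac12$, where $W$ is a standard Brownian motion and $f:[-\tfrac12,\tfrac12]\to\mathbb R$. Let $z_a=\Phi^{-1}(1-a)$, with $\Phi$ the standard normal distribution function. For $j\ge1$ put $$\delta_j=2^{j-1}\bigl(Y(2^{-j})-Y(-2^{-j})\bigr),\qquad T_j=\delta_j-\delta_{j+1},\qquad \sigma_j=\sqrt{2^{j-1}/n},$$ $$\mathrm{CI}^c_j(a)=\bigl[\,2\delta_{j+1}-\delta_j-z_{a/2}\sqrt5\,\sigma_j,\ \delta_{j+1}+z_{a/2}\,\sigma_{j+1}\bigr],$$ where the interval is empty, of length $0$, if its left endpoint exceeds its right endpoint. Let $$\hat j=\inf\{j\ge1: T_j\le z_\alpha\sigma_j\},\qquad \mathrm{CI}^c_*=\mathrm{CI}^c_{\hat j}(\alpha/6),$$ and, for given $f$, let $j_*^c$ be the smallest $j\ge1$ with $E_fT_j\le\tfrac23 z_\alpha\sigma_j$. Denote by $L(\cdot)$ the length of an interval. Then for every convex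 function $f$ on $[-\tfrac12,\tfrac12]$ the index $\hat j$ is almost surely finite, $j_*^c$ exists, the variables $T_j$ and $L(\mathrm{CI}^c_*)$ have finite expectations, and $$P_f\bigl(f(0)\in\mathrm{CI}^c_*\bigr)\ge1-\alpha,$$ $$E_fL(\mathrm{CI}^c_*)\le1.25\bigl(z_\alpha+(\sqrt5+\sqrt2)\,z_{\alpha/12}\bigr)\sigma_{j_*^c}\le12.79\,z_\alpha\,\sigma_{j_*^c}.$$ -/

import Mathlib

open MeasureTheory ProbabilityTheory

namespace ConvexCI

noncomputable section

/-- The upper `α` quantile `z_α = Φ⁻¹(1 - α)` of the standard normal distribution, with the quantile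
function `Φ⁻¹ p = inf {x | p ≤ Φ x}`. -/
def z (α : ℝ) : ℝ :=
  sInf {x : ℝ | 1 - α ≤ cdf (gaussianReal 0 1) x}

/-- `W` is a Brownian motion with unit diffusion on the time interval `[-1/2, 1/2]`: independent
increments, `W t - W s ∼ N(0, t - s)` for `s ≤ t`, and almost surely continuous paths. The value at
a reference time is not fixed, since only increments of `W` enter the white noise model; so this
covers both `W (-1/2) = 0` and `W 0 = 0`. -/
structure IsBrownianOnInterval {Ω : Type*} [MeasurableSpace Ω] (W : ℝ → Ω → ℝ)
    (P : Measure Ω) : Prop where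
  indep_increments :
    HasIndepIncrements (fun (t : Set.Icc (-1 / 2 : ℝ) (1 / 2)) (ω : Ω) => W t ω) P
  law_increments : ∀ s ∈ Set.Icc (-1 / 2 : ℝ) (1 / 2), ∀ t ∈ Set.Icc (-1 / 2 : ℝ) (1 / 2), s ≤ t →
    HasLaw (fun ω => W t ω - W s ω) (gaussianReal 0 (t - s).toNNReal) P
  continuous_paths : ∀ᵐ ω ∂P, ContinuousOn (fun t => W t ω) (Set.Icc (-1 / 2 : ℝ) (1 / 2))

/-- The process `Y` is an observation from the white noise model
`dY(t) = f(t) dt + n^{-1/2} dW(t)`, `-1/2 ≤ t ≤ 1/2`, in integrated form. -/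
def IsWhiteNoiseObservation {Ω : Type*} [MeasurableSpace Ω] (Y : ℝ → Ω → ℝ) (f : ℝ → ℝ) (n : ℝ)
    (P : Measure Ω) : Prop :=
  ∃ W : ℝ → Ω → ℝ, IsBrownianOnInterval W P ∧
    ∀ᵐ ω ∂P, ∀ s ∈ Set.Icc (-1 / 2 : ℝ) (1 / 2), ∀ t ∈ Set.Icc (-1 / 2 : ℝ) (1 / 2),
      Y t ω - Y s ω = (∫ u in s..t, f u) + (Real.sqrt n)⁻¹ * (W t ω - W s ω)

/-- `σ_j`, where `σ_j² = 2^{j-1} / n`. -/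
def sigma (n : ℝ) (j : ℕ) : ℝ :=
  Real.sqrt ((2 : ℝ) ^ ((j : ℤ) - 1) / n)

/-- `δ_j = 2^{j-1} (y(2^{-j}) - y(-2^{-j}))`, a function of the observed path `y`. -/
def delta (y : ℝ → ℝ) (j : ℕ) : ℝ :=
  (2 : ℝ) ^ ((j : ℤ) - 1) * (y ((2 : ℝ) ^ (-(j : ℤ))) - y (-(2 : ℝ) ^ (-(j : ℤ))))

/-- `T_j = δ_j - δ_{j+1}`. -/
def T (y : ℝ → ℝ) (j : ℕ) : ℝ :=
  delta y j - delta y (j + 1)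

/-- The confidence interval
`CI_j^c(α) = [2δ_{j+1} - δ_j - z_{α/2} √5 σ_j, δ_{j+1} + z_{α/2} σ_{j+1}]`
(empty if the left endpoint exceeds the right one). -/
def CI (n α : ℝ) (y : ℝ → ℝ) (j : ℕ) : Set ℝ :=
  Set.Icc (2 * delta y (j + 1) - delta y j - z (α / 2) * Real.sqrt 5 * sigma n j)
    (delta y (j + 1) + z (α / 2) * sigma n (j + 1))

/-- The indices `j ≥ 1` with `T_j ≤ z_α σ_j`. -/
def selectable (n α : ℝ) (y : ℝ → ℝ) : Set ℕ :=
  {j : ℕ | 1 ≤ j ∧ T y j ≤ z α * sigma n j}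

/-- The selected index `ĵ = inf {j ≥ 1 | T_j ≤ z_α σ_j}`. -/
def jHat (n α : ℝ) (y : ℝ → ℝ) : ℕ :=
  sInf (selectable n α y)

/-- The adaptive confidence interval `CI_*^c = CI_ĵ^c(α / 6)`. -/
def CIStar (n α : ℝ) (y : ℝ → ℝ) : Set ℝ :=
  CI n (α / 6) y (jHat n α y)

/-- The length of a confidence interval (`0` for the empty one). -/
def length (C : Set ℝ) : ℝ :=
  volume.real C

/-- The indices `j ≥ 1` with `E T_j ≤ (2/3) z_α σ_j`. -/
def oracleSet {Ω : Type*} [MeasurableSpace Ω] (n α : ℝ) (Y : ℝ → Ω → ℝ) (P : Measure Ω) : Set ℕ :=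
  {j : ℕ | 1 ≤ j ∧ ∫ ω, T (fun t => Y t ω) j ∂P ≤ 2 / 3 * z α * sigma n j}

/-- The benchmark index `j_*^c`, the smallest `j ≥ 1` with `E T_j ≤ (2/3) z_α σ_j`. -/
def jStar {Ω : Type*} [MeasurableSpace Ω] (n α : ℝ) (Y : ℝ → Ω → ℝ) (P : Measure Ω) : ℕ :=
  sInf (oracleSet n α Y P)

end

end ConvexCI

/-! Write A(h) for the average of f over [-h, h] and J for the benchmark index. The mean of `T` at
level j is A(2^(-j)) - A(2^(-j-1)), and convexity enters only through three inequalities integrated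
pointwise. The bounds 2A(h/2) - A(h) ≤ f(0) ≤ A(h) make every fixed-level interval valid
(`measureReal_notMem_CI_le`). The bound `symmAverage_sub_half_le` says that the mean of `T` at least
halves from one level to the next. Its standard deviation `sigma` grows by √2, so its mean in units
of `sigma` drops at least by the factor 2√2 per level. The `T` at different levels are independent,
because the covariance of the noise at levels i ≤ j depends only on i (`iIndepFun_noise_sub`).

Coverage spends the error budget α as follows. The five levels J-2, ..., J+2 cost α/6 each by a
union bound. Selection at J+3 or later requires three independent threshold exceedances, of
probability at most (1/6 - 1/50)α (`gaussianTail_triple_product_le`). Selection at J-3 or earlier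
requires `T` to fall far below its mean, with probabilities summing to at most α/50
(`measureReal_early_selection_le`).

For the length, the selection rule bounds T at the selected level, so the length is at most a
constant times the selected `sigma`. Its expectation telescopes over the levels above J
(`sigma_jHat_le`). The exceedance probabilities decay faster than √2^N grows, giving the factor
1.25. The final constant is a comparison of the quantiles at α/12 and α (`z_div_twelve_le`). -/

namespace ConvexCI

/-! ### The standard normal density and tail -/

/-- The standard normal density. -/
noncomputable def gaussianDensity (x : ℝ) : ℝ := (√(2 * Real.pi))⁻¹ * Real.exp (-(x ^ 2 / 2))

/-- The upper tail `1 - Φ` of the standard normal distribution. -/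
noncomputable def gaussianTail (x : ℝ) : ℝ := 1 - cdf (gaussianReal 0 1) x

lemma gaussianDensity_pos (x : ℝ) : 0 < gaussianDensity x := by
  unfold gaussianDensity; positivity

lemma gaussianPDFReal_eq_gaussianDensity (x : ℝ) : gaussianPDFReal 0 1 x = gaussianDensity x := by
  simp [gaussianPDFReal, gaussianDensity, neg_div]

lemma continuous_gaussianDensity : Continuous gaussianDensity := by
  unfold gaussianDensity; fun_prop

lemma integrable_gaussianDensity : Integrable gaussianDensity := by
  have := integrable_gaussianPDFReal 0 1
  rwa [funext gaussianPDFReal_eq_gaussianDensity] at this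

lemma cdf_gaussianReal_eq_integral (x : ℝ) :
    cdf (gaussianReal 0 1) x = ∫ t in Set.Iic x, gaussianDensity t := by
  rw [cdf_eq_real, measureReal_def, gaussianReal_apply_eq_integral 0 one_ne_zero,
    ENNReal.toReal_ofReal]
  · simp_rw [gaussianPDFReal_eq_gaussianDensity]
  · exact setIntegral_nonneg measurableSet_Iic fun t _ => gaussianPDFReal_nonneg _ _ _

lemma hasDerivAt_gaussianTail (x : ℝ) : HasDerivAt gaussianTail (-gaussianDensity x) x := by
  have h1 : ∀ y, gaussianTail y =
      1 - (∫ t in Set.Iic 0, gaussianDensity t) - ∫ t in (0 : ℝ)..y, gaussianDensity t := by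
    intro y
    rw [gaussianTail, cdf_gaussianReal_eq_integral,
      ← intervalIntegral.integral_Iic_sub_Iic integrable_gaussianDensity.integrableOn
        integrable_gaussianDensity.integrableOn]
    ring
  rw [funext h1]
  have := (continuous_gaussianDensity.integral_hasStrictDerivAt 0 x).hasDerivAt
  simpa using this.const_sub (1 - ∫ t in Set.Iic 0, gaussianDensity t)

lemma continuous_gaussianTail : Continuous gaussianTail :=
  continuous_iff_continuousAt.2 fun x => (hasDerivAt_gaussianTail x).continuousAt

lemma strictAnti_gaussianTail : StrictAnti gaussianTail :=
  strictAnti_of_hasDerivAt_neg hasDerivAt_gaussianTail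
    fun x => neg_neg_of_pos (gaussianDensity_pos x)

lemma tendsto_gaussianTail_atTop : Filter.Tendsto gaussianTail Filter.atTop (nhds 0) := by
  have := (tendsto_cdf_atTop (gaussianReal 0 1)).const_sub 1
  simpa [gaussianTail] using! this

lemma tendsto_gaussianTail_atBot : Filter.Tendsto gaussianTail Filter.atBot (nhds 1) := by
  have := (tendsto_cdf_atBot (gaussianReal 0 1)).const_sub 1
  simpa [gaussianTail] using! this

lemma gaussianTail_nonneg (x : ℝ) : 0 ≤ gaussianTail x := sub_nonneg.2 (cdf_le_one _ _)

lemma gaussianReal_Ioi (x : ℝ) : (gaussianReal 0 1).real (Set.Ioi x) = gaussianTail x := by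
  rw [gaussianTail, cdf_eq_real, ← Set.compl_Iic, probReal_compl_eq_one_sub measurableSet_Iic]

lemma gaussianTail_neg (x : ℝ) : gaussianTail (-x) = 1 - gaussianTail x := by
  have h : (gaussianReal 0 1).map (fun y => -y) = gaussianReal 0 1 := by
    simpa using gaussianReal_map_neg (μ := 0) (v := 1)
  have h2 : (gaussianReal 0 1).real (Set.Ioi (-x)) = (gaussianReal 0 1).real (Set.Iio x) := by
    conv_lhs => rw [← h]
    rw [map_measureReal_apply measurable_neg measurableSet_Ioi]
    congr 1
    ext y; simp
  have : NullSingletonClass (gaussianReal 0 1) := nullSingletonClass_gaussianReal one_ne_zero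
  rw [← gaussianReal_Ioi, h2, gaussianTail, cdf_eq_real, sub_sub_cancel]
  exact measureReal_congr Iio_ae_eq_Iic

lemma gaussianTail_zero : gaussianTail 0 = 1 / 2 := by
  have := gaussianTail_neg 0
  simp only [neg_zero] at this
  linarith

/-- A function with nonpositive derivative on `[a, ∞)` and limit `0` at infinity is nonnegative
at `a`. -/
lemma nonneg_of_deriv_nonpos_of_tendsto_zero {g g' : ℝ → ℝ} {a : ℝ}
    (hg : ∀ x, a ≤ x → HasDerivAt g (g' x) x) (hg' : ∀ x, a ≤ x → g' x ≤ 0)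
    (hlim : Filter.Tendsto g Filter.atTop (nhds 0)) : 0 ≤ g a := by
  have hanti : AntitoneOn g (Set.Ici a) := by
    refine antitoneOn_of_deriv_nonpos (convex_Ici a)
      (fun x hx => (hg x hx).continuousAt.continuousWithinAt)
      (fun x hx => ?_) (fun x hx => ?_)
    · rw [interior_Ici] at hx
      exact (hg x hx.le).differentiableAt.differentiableWithinAt
    · rw [interior_Ici] at hx
      rw [(hg x hx.le).deriv]
      exact hg' x hx.le
  refine le_of_tendsto hlim ?_
  filter_upwards [Filter.eventually_ge_atTop a] with x hx using hanti (Set.mem_Ici.2 le_rfl) hx hx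

/-- Shifting the argument of the Gaussian tail costs at least the ratio of the densities. -/
lemma gaussianTail_le_mul_exp {x y : ℝ} (hxy : x ≤ y) :
    gaussianTail y ≤ gaussianTail x * Real.exp (-(y ^ 2 - x ^ 2) / 2) := by
  set c := Real.exp (-(y ^ 2 - x ^ 2) / 2) with hc
  have key : 0 ≤ gaussianTail x * c - gaussianTail (x + (y - x)) := by
    refine nonneg_of_deriv_nonpos_of_tendsto_zero
      (g := fun u => gaussianTail u * c - gaussianTail (u + (y - x)))
      (g' := fun u => -gaussianDensity u * c - -gaussianDensity (u + (y - x))) ?_ ?_ ?_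
    · intro u _
      exact ((hasDerivAt_gaussianTail u).mul_const c).sub
        ((hasDerivAt_gaussianTail _).comp_add_const u (y - x))
    · intro u hu
      -- With d = y - x ≥ 0, the density ratio at u + d and u is exp(-(2ud + d²)/2), which decreases
      -- in u and equals c at u = x.
      have : gaussianDensity (u + (y - x)) ≤ gaussianDensity u * c := by
        rw [gaussianDensity, gaussianDensity, mul_assoc, hc, ← Real.exp_add]
        gcongr
        nlinarith
      linarith
    · have h1 := tendsto_gaussianTail_atTop.mul_const c
      have h2 := tendsto_gaussianTail_atTop.comp
        (Filter.tendsto_atTop_add_const_right Filter.atTop (y - x) Filter.tendsto_id)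
      simpa using! h1.sub h2
  rw [add_sub_cancel] at key
  linarith

/-- The lower Mills ratio bound. -/
lemma mul_gaussianDensity_le (x : ℝ) :
    x * gaussianDensity x ≤ (1 + x ^ 2) * gaussianTail x := by
  have hd : ∀ u, HasDerivAt gaussianDensity (-u * gaussianDensity u) u := by
    intro u
    have h : HasDerivAt (fun y : ℝ => -(y ^ 2 / 2)) (-u) u := by
      have := ((hasDerivAt_pow 2 u).div_const 2).neg
      convert! this using 1; norm_num
    have := (h.exp).const_mul (√(2 * Real.pi))⁻¹
    convert! this using 1
    rw [gaussianDensity]; ring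
  -- The difference tends to 0 at infinity and its derivative collapses to -2φ(u)/(1 + u²)².
  have key : 0 ≤ gaussianTail x - x / (1 + x ^ 2) * gaussianDensity x := by
    refine nonneg_of_deriv_nonpos_of_tendsto_zero
      (g := fun u => gaussianTail u - u / (1 + u ^ 2) * gaussianDensity u)
      (g' := fun u => -2 / (1 + u ^ 2) ^ 2 * gaussianDensity u) ?_ ?_ ?_
    · intro u _
      have h1 : HasDerivAt (fun y : ℝ => y / (1 + y ^ 2))
          ((1 * (1 + u ^ 2) - u * (2 * u)) / (1 + u ^ 2) ^ 2) u := by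
        refine (hasDerivAt_id u).div ?_ (by positivity)
        have := (hasDerivAt_pow 2 u).const_add 1
        convert! this using 1; norm_num
      convert! (hasDerivAt_gaussianTail u).sub (h1.mul (hd u)) using 1
      have : (1 + u ^ 2) ≠ 0 := by positivity
      field_simp
      ring
    · intro u _
      have := gaussianDensity_pos u
      have h2 : 0 < (1 + u ^ 2) ^ 2 := by positivity
      have : -2 / (1 + u ^ 2) ^ 2 ≤ 0 := div_nonpos_of_nonpos_of_nonneg (by norm_num) h2.le
      nlinarith
    · have hb : Filter.Tendsto gaussianDensity Filter.atTop (nhds 0) := by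
        have : Filter.Tendsto (fun y : ℝ => y ^ 2 / 2) Filter.atTop Filter.atTop :=
          (Filter.tendsto_pow_atTop two_ne_zero).atTop_div_const (by norm_num)
        have := (Real.tendsto_exp_neg_atTop_nhds_zero.comp this).const_mul (√(2 * Real.pi))⁻¹
        rw [mul_zero] at this
        exact this
      have h3 : Filter.Tendsto (fun u => u / (1 + u ^ 2) * gaussianDensity u)
          Filter.atTop (nhds 0) := by
        refine squeeze_zero_norm (fun u => ?_) hb
        have hu : |u / (1 + u ^ 2)| ≤ 1 := by
          rw [abs_div, abs_of_pos (by positivity : 0 < 1 + u ^ 2), div_le_one (by positivity)]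
          nlinarith [sq_abs u, sq_nonneg (|u| - 1), abs_nonneg u]
        rw [Real.norm_eq_abs, abs_mul, abs_of_pos (gaussianDensity_pos u)]
        exact mul_le_of_le_one_left (gaussianDensity_pos u).le hu
      simpa using tendsto_gaussianTail_atTop.sub h3
  have hpos : 0 < 1 + x ^ 2 := by positivity
  have : x / (1 + x ^ 2) * gaussianDensity x ≤ gaussianTail x := by linarith
  rw [div_mul_eq_mul_div, div_le_iff₀ hpos] at this
  linarith

lemma gaussianTail_le_add_mul_density {x y : ℝ} (hx : 0 ≤ x) (hxy : x ≤ y) :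
    gaussianTail x ≤ gaussianTail y + (y - x) * gaussianDensity x := by
  rcases hxy.eq_or_lt with rfl | hlt
  · simp
  obtain ⟨c, hc, hc'⟩ := exists_hasDerivAt_eq_slope gaussianTail (fun u => -gaussianDensity u) hlt
    continuous_gaussianTail.continuousOn (fun u _ => hasDerivAt_gaussianTail u)
  have hle : gaussianDensity c ≤ gaussianDensity x := by
    unfold gaussianDensity
    have := hc.1
    gcongr
  rw [eq_div_iff (by linarith : y - x ≠ 0)] at hc'
  nlinarith

/-! ### The quantile -/

/-- The tail attains `a` at some x by the intermediate value theorem; strict monotonicity turns the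
set in the definition of `z` into the half-line from x. -/
lemma gaussianTail_z {a : ℝ} (h0 : 0 < a) (h1 : a < 1) : gaussianTail (z a) = a := by
  obtain ⟨x, hx⟩ : ∃ x, gaussianTail x = a := by
    have := mem_range_of_exists_le_of_exists_ge continuous_gaussianTail
      (c := a) (tendsto_gaussianTail_atTop.eventually_le_const h0).exists
      (tendsto_gaussianTail_atBot.eventually_const_le h1).exists
    exact this
  have : {y : ℝ | 1 - a ≤ cdf (gaussianReal 0 1) y} = Set.Ici x := by
    ext y
    rw [Set.mem_ofPred_eq, Set.mem_Ici, ← strictAnti_gaussianTail.le_iff_ge (a := y) (b := x), hx,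
      gaussianTail]
    constructor <;> intro h <;> linarith
  rw [z, this, csInf_Ici, hx]

/-! ### Numerical bounds for the Gaussian tail -/

/-- The signed Taylor remainder of order m + 1 vanishes at 0 and its derivative is the signed
remainder of order m, so the sign propagates by induction. -/
lemma alternating_exp_neg (m : ℕ) : ∀ u : ℝ, 0 ≤ u →
    0 ≤ (-1) ^ m * (Real.exp (-u) - ∑ k ∈ Finset.range m, (-u) ^ k / (k.factorial : ℝ)) := by
  induction m with
  | zero => intro u _; simpa using (Real.exp_pos (-u)).le
  | succ m ih =>
    set g : ℝ → ℝ := fun u => (-1) ^ (m + 1) *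
      (Real.exp (-u) - ∑ k ∈ Finset.range (m + 1), (-u) ^ k / (k.factorial : ℝ)) with hgdef
    have hg : ∀ u, HasDerivAt g
        ((-1) ^ m * (Real.exp (-u) - ∑ k ∈ Finset.range m, (-u) ^ k / (k.factorial : ℝ))) u := by
      intro u
      have he : HasDerivAt (fun y : ℝ => Real.exp (-y)) (Real.exp (-u) * -1) u :=
        (hasDerivAt_neg u).exp
      have hs : HasDerivAt (fun y : ℝ => ∑ k ∈ Finset.range (m + 1), (-y) ^ k / (k.factorial : ℝ))
          (∑ k ∈ Finset.range (m + 1), (k * (-u) ^ (k - 1) * -1) / (k.factorial : ℝ)) u :=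
        HasDerivAt.fun_sum fun k _ => ((hasDerivAt_neg u).pow k).div_const _
      convert! (he.sub hs).const_mul ((-1 : ℝ) ^ (m + 1)) using 1
      rw [Finset.sum_range_succ']
      have : ∀ k ∈ Finset.range m, (((k + 1 : ℕ) : ℝ) * (-u) ^ (k + 1 - 1) * -1) /
          ((k + 1).factorial : ℝ) = -((-u) ^ k / (k.factorial : ℝ)) := by
        intro k _
        rw [Nat.factorial_succ]
        push_cast
        have : (k : ℝ) + 1 ≠ 0 := by positivity
        have : (k.factorial : ℝ) ≠ 0 := by positivity
        field_simp
      rw [Finset.sum_congr rfl this, Finset.sum_neg_distrib, pow_succ]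
      simp
      ring
    have hmono : MonotoneOn g (Set.Ici 0) := by
      refine monotoneOn_of_deriv_nonneg (convex_Ici 0)
        (fun x _ => (hg x).continuousAt.continuousWithinAt)
        (fun x _ => (hg x).differentiableAt.differentiableWithinAt) (fun x hx => ?_)
      rw [interior_Ici] at hx
      rw [(hg x).deriv]
      exact ih x (le_of_lt hx)
    intro u hu
    have h0 : g 0 = 0 := by simp [hgdef, Finset.sum_range_succ']
    exact h0 ▸ hmono (Set.mem_Ici.2 le_rfl) (Set.mem_Ici.2 hu) hu

/-- Partial sums of the power series of `∫₀ˣ exp (-t²/2) dt`. -/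
noncomputable def erfPartialSum (m : ℕ) (x : ℝ) : ℝ :=
  ∑ k ∈ Finset.range m, (-1) ^ k * x ^ (2 * k + 1) / (2 ^ k * (k.factorial : ℝ) * (2 * k + 1))

/-- The derivative in x is `alternating_exp_neg` at x²/2. Even partial sums thus bound the tail from
above and odd ones from below, which yields certified rational estimates. -/
lemma alternating_gaussianTail (m : ℕ) {x : ℝ} (hx : 0 ≤ x) :
    0 ≤ (-1) ^ m * (1 / 2 - gaussianTail x - (√(2 * Real.pi))⁻¹ * erfPartialSum m x) := by
  set g : ℝ → ℝ := fun y =>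
    (-1) ^ m * (1 / 2 - gaussianTail y - (√(2 * Real.pi))⁻¹ * erfPartialSum m y) with hgdef
  have hg : ∀ y, HasDerivAt g ((√(2 * Real.pi))⁻¹ * ((-1) ^ m * (Real.exp (-(y ^ 2 / 2)) -
      ∑ k ∈ Finset.range m, (-(y ^ 2 / 2)) ^ k / (k.factorial : ℝ)))) y := by
    intro y
    have hs : HasDerivAt (erfPartialSum m) (∑ k ∈ Finset.range m, (-1) ^ k *
        (((2 * k + 1 : ℕ) : ℝ) * y ^ (2 * k + 1 - 1)) / (2 ^ k * (k.factorial : ℝ) * (2 * k + 1)))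
        y :=
      HasDerivAt.fun_sum fun k _ => ((hasDerivAt_pow (2 * k + 1) y).const_mul _).div_const _
    convert! (((hasDerivAt_gaussianTail y).const_sub (1 / 2)).sub
      (hs.const_mul (√(2 * Real.pi))⁻¹)).const_mul ((-1 : ℝ) ^ m) using 1
    have : ∀ k ∈ Finset.range m, (-1) ^ k * (((2 * k + 1 : ℕ) : ℝ) * y ^ (2 * k + 1 - 1)) /
        (2 ^ k * (k.factorial : ℝ) * (2 * k + 1)) = (-(y ^ 2 / 2)) ^ k / (k.factorial : ℝ) := by
      intro k _
      have h1 : (2 * k + 1 : ℝ) ≠ 0 := by positivity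
      have h2 : (k.factorial : ℝ) ≠ 0 := by positivity
      rw [neg_pow (y ^ 2 / 2), div_pow, ← pow_mul, Nat.add_sub_cancel]
      push_cast
      field_simp
    rw [Finset.sum_congr rfl this, gaussianDensity]
    ring
  have hmono : MonotoneOn g (Set.Ici 0) := by
    refine monotoneOn_of_deriv_nonneg (convex_Ici 0)
      (fun x _ => (hg x).continuousAt.continuousWithinAt)
      (fun x _ => (hg x).differentiableAt.differentiableWithinAt) (fun x _ => ?_)
    rw [(hg x).deriv]
    exact mul_nonneg (by positivity) (alternating_exp_neg m _ (by positivity))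
  have h0 : g 0 = 0 := by simp [hgdef, gaussianTail_zero, erfPartialSum]
  exact h0 ▸ hmono (Set.mem_Ici.2 le_rfl) (Set.mem_Ici.2 hx) hx

lemma inv_sqrt_two_pi_bounds :
    (0.398942 : ℝ) ≤ (√(2 * Real.pi))⁻¹ ∧ (√(2 * Real.pi))⁻¹ ≤ 0.398943 := by
  have h1 := Real.pi_gt_d6
  have h2 := Real.pi_lt_d6
  constructor
  · rw [le_inv_comm₀ (by norm_num) (by positivity)]
    refine Real.sqrt_le_iff.2 ⟨by norm_num, ?_⟩
    norm_num at h2 ⊢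
    linarith
  · rw [inv_le_comm₀ (by positivity) (by norm_num)]
    refine Real.le_sqrt_of_sq_le ?_
    norm_num at h1 ⊢
    linarith

lemma gaussianTail_le_of_even {m : ℕ} (hm : Even m) {x q : ℝ} (hx : 0 ≤ x)
    (hp : 0 ≤ erfPartialSum m x) (h : 1 / 2 - 0.398942 * erfPartialSum m x ≤ q) :
    gaussianTail x ≤ q := by
  have h1 := alternating_gaussianTail m hx
  rw [hm.neg_one_pow, one_mul] at h1
  have := mul_le_mul_of_nonneg_right inv_sqrt_two_pi_bounds.1 hp
  linarith

lemma le_gaussianTail_of_odd {m : ℕ} (hm : Odd m) {x q : ℝ} (hx : 0 ≤ x)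
    (hp : 0 ≤ erfPartialSum m x) (h : q ≤ 1 / 2 - 0.398943 * erfPartialSum m x) :
    q ≤ gaussianTail x := by
  have h1 := alternating_gaussianTail m hx
  rw [hm.neg_one_pow] at h1
  have := mul_le_mul_of_nonneg_right inv_sqrt_two_pi_bounds.2 hp
  linarith

/-- The points 0.28, 0.6419 and 0.77 are 0.84 times (rounded down) the relative thresholds 1/3, 1 -
√2/6 and 11/12; 0.84 lies just below every `z α` with α ≤ 0.2. -/
lemma gaussianTail_le_39 : gaussianTail 0.28 ≤ 0.39 := by
  refine gaussianTail_le_of_even (m := 2) (by decide) (by norm_num) ?_ ?_ <;>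
  norm_num [erfPartialSum, Finset.sum_range_succ, Nat.factorial]

lemma gaussianTail_le_261 : gaussianTail 0.6419 ≤ 0.261 := by
  refine gaussianTail_le_of_even (m := 4) (by decide) (by norm_num) ?_ ?_ <;>
  norm_num [erfPartialSum, Finset.sum_range_succ, Nat.factorial]

lemma gaussianTail_le_222 : gaussianTail 0.77 ≤ 0.222 := by
  refine gaussianTail_le_of_even (m := 4) (by decide) (by norm_num) ?_ ?_ <;>
  norm_num [erfPartialSum, Finset.sum_range_succ, Nat.factorial]

lemma le_gaussianTail_20 : 1 / 5 ≤ gaussianTail 0.8415 := by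
  refine le_gaussianTail_of_odd (m := 7) (by decide) (by norm_num) ?_ ?_ <;>
  norm_num [erfPartialSum, Finset.sum_range_succ, Nat.factorial]

lemma gaussianTail_le_one_div_60 : gaussianTail 2.1282 ≤ 1 / 60 := by
  refine gaussianTail_le_of_even (m := 14) (by decide) (by norm_num) ?_ ?_ <;>
  norm_num [erfPartialSum, Finset.sum_range_succ, Nat.factorial]

/-! ### Comparison of the quantiles at `a` and `a / 12` -/

lemma z_lower_bound {a : ℝ} (h0 : 0 < a) (h1 : a ≤ 0.2) : 0.8415 ≤ z a := by
  rw [← strictAnti_gaussianTail.le_iff_ge, gaussianTail_z h0 (by norm_num at h1; linarith)]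
  have := le_gaussianTail_20
  norm_num at this h1 ⊢
  linarith

/-- If φ(cy)/φ(y) ≤ 1/12, shifting the tail already suffices. Otherwise this ratio exceeds 1/12 on
all of [0.8415, y], so tail(u) - 12 tail(cu) increases there, and it starts nonnegative since 12 ·
(1/60) = 1/5. -/
lemma gaussianTail_mul_le_div_twelve {c y : ℝ} (hc1 : 1 ≤ c) (hc : 2.1282 ≤ c * 0.8415)
    (hy : 0.8415 ≤ y) : gaussianTail (c * y) ≤ gaussianTail y / 12 := by
  by_cases hcase : Real.exp (-((c * y) ^ 2 - y ^ 2) / 2) ≤ 1 / 12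
  · have h1 : y ≤ c * y := by nlinarith
    have := gaussianTail_le_mul_exp h1
    have := mul_le_mul_of_nonneg_left hcase (gaussianTail_nonneg y)
    linarith
  · push Not at hcase
    set g : ℝ → ℝ := fun u => gaussianTail u - 12 * gaussianTail (c * u) with hgdef
    have hg : ∀ u, HasDerivAt g
        (-gaussianDensity u - 12 * (-gaussianDensity (c * u) * (c * 1))) u := fun u =>
      (hasDerivAt_gaussianTail u).sub
        (((hasDerivAt_gaussianTail (c * u)).comp u ((hasDerivAt_id u).const_mul c)).const_mul 12)
    have hmono : MonotoneOn g (Set.Icc 0.8415 y) := by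
      refine monotoneOn_of_deriv_nonneg (convex_Icc _ _)
        (fun x _ => (hg x).continuousAt.continuousWithinAt)
        (fun x _ => (hg x).differentiableAt.differentiableWithinAt) (fun x hx => ?_)
      rw [interior_Icc] at hx
      rw [(hg x).deriv]
      have hx0 : 0 < x := by linarith [hx.1]
      have h1 : 1 / 12 ≤ Real.exp (-((c * x) ^ 2 - x ^ 2) / 2) := by
        refine hcase.le.trans (Real.exp_le_exp.2 ?_)
        have h2 : 0 ≤ c ^ 2 - 1 := by nlinarith
        have h3 : x ^ 2 ≤ y ^ 2 := by gcongr; exact hx.2.le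
        nlinarith [mul_le_mul_of_nonneg_left h3 h2]
      have h4 : gaussianDensity (c * x) =
          gaussianDensity x * Real.exp (-((c * x) ^ 2 - x ^ 2) / 2) := by
        rw [gaussianDensity, gaussianDensity, mul_assoc, ← Real.exp_add]
        ring_nf
      have h5 := mul_le_mul_of_nonneg_left h1 (gaussianDensity_pos x).le
      rw [← h4] at h5
      have h6 := gaussianDensity_pos (c * x)
      nlinarith
    have h0 : 0 ≤ g 0.8415 := by
      have h1 := strictAnti_gaussianTail.antitone hc
      have h2 := gaussianTail_le_one_div_60
      have h3 := le_gaussianTail_20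
      simp only [hgdef]
      linarith
    have h1 := hmono ⟨le_rfl, hy⟩ ⟨hy, le_rfl⟩ hy
    simp only [hgdef] at h1 h0
    linarith

lemma z_div_twelve_le {a : ℝ} (h0 : 0 < a) (h1 : a ≤ 0.2) :
    (√5 + √2) * z (a / 12) ≤ 9.232 * z a := by
  have ha : a < 1 := by norm_num at h1; linarith
  have h5 : √5 ≤ 2.2361 := Real.sqrt_le_iff.2 ⟨by norm_num, by norm_num⟩
  have h2 : √2 ≤ 1.41422 := Real.sqrt_le_iff.2 ⟨by norm_num, by norm_num⟩
  have h5' : 1 ≤ √5 := Real.le_sqrt_of_sq_le (by norm_num)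
  have h2' : 1 ≤ √2 := Real.le_sqrt_of_sq_le (by norm_num)
  have hs : 0 < √5 + √2 := by linarith
  have hz := z_lower_bound h0 h1
  -- 9.232 is the value with 1.25 · (1 + 9.232) = 12.79; the multiplier is about 2.529 and still
  -- meets 2.1282 / 0.8415.
  have key : gaussianTail (9.232 / (√5 + √2) * z a) ≤ gaussianTail (z (a / 12)) := by
    rw [gaussianTail_z (by linarith) (by linarith)]
    refine (gaussianTail_mul_le_div_twelve ?_ ?_ hz).trans_eq ?_
    · rw [le_div_iff₀ hs]; linarith
    · rw [div_mul_eq_mul_div, le_div_iff₀ hs]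
      linarith
    · rw [gaussianTail_z h0 ha]
  rw [strictAnti_gaussianTail.le_iff_ge] at key
  calc (√5 + √2) * z (a / 12) ≤ (√5 + √2) * (9.232 / (√5 + √2) * z a) := by gcongr
    _ = 9.232 * z a := by field_simp

/-! ### Tails at the relative thresholds and far below the benchmark -/

/-- Lower bound for `1 - √2 / 6`, the second of the relative thresholds. -/
lemma one_sub_sqrt_two_div_six : 0.7642 ≤ 1 - √2 / 6 := by
  have h2 : √2 ≤ 1.41422 := Real.sqrt_le_iff.2 ⟨by norm_num, by norm_num⟩
  linarith

lemma gaussianTail_div_three_le {y : ℝ} (hy : 0.84 ≤ y) : gaussianTail (y / 3) ≤ 0.39 :=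
  (strictAnti_gaussianTail.antitone (by linarith)).trans gaussianTail_le_39

lemma gaussianTail_second_le {y : ℝ} (hy : 0.84 ≤ y) :
    gaussianTail ((1 - √2 / 6) * y) ≤ 0.261 :=
  (strictAnti_gaussianTail.antitone
    (by nlinarith [one_sub_sqrt_two_div_six])).trans gaussianTail_le_261

lemma gaussianTail_third_le {y : ℝ} (hy : 0.84 ≤ y) : gaussianTail (11 / 12 * y) ≤ 0.222 :=
  (strictAnti_gaussianTail.antitone (by linarith)).trans gaussianTail_le_222

/-- A bound relative to the tail at y is needed, since that tail will be α. The mean value estimate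
costs (y/12)φ(11y/12), and the Mills bound converts yφ(y) back into the tail; 23/288 = (1 -
(11/12)²)/2. -/
lemma gaussianTail_third_le_mul {y : ℝ} (hy : 0.84 ≤ y) :
    gaussianTail (11 / 12 * y) ≤
      gaussianTail y * (1 + (1 + y ^ 2) / 12 * Real.exp (23 / 288 * y ^ 2)) := by
  have h1 := gaussianTail_le_add_mul_density (x := 11 / 12 * y) (y := y) (by linarith) (by linarith)
  have h2 : gaussianDensity (11 / 12 * y) = gaussianDensity y * Real.exp (23 / 288 * y ^ 2) := by
    rw [gaussianDensity, gaussianDensity, mul_assoc, ← Real.exp_add]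
    ring_nf
  have h3 := mul_le_mul_of_nonneg_right (mul_gaussianDensity_le y)
    (Real.exp_pos (23 / 288 * y ^ 2)).le
  rw [h2] at h1
  nlinarith

/-- Here 0.7056 = 0.84² and 0.29 < 0.7642²/2. The exponential decay will absorb the growing factor
of `gaussianTail_third_le_mul`. -/
lemma gaussianTail_second_le_exp {y : ℝ} (hy : 0.84 ≤ y) :
    gaussianTail ((1 - √2 / 6) * y) ≤ 0.261 * Real.exp (-(0.29 * (y ^ 2 - 0.7056))) := by
  have h1 : gaussianTail ((1 - √2 / 6) * y) ≤ gaussianTail (0.7642 * y) :=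
    strictAnti_gaussianTail.antitone
      (mul_le_mul_of_nonneg_right one_sub_sqrt_two_div_six (by linarith))
  have h2 := gaussianTail_le_mul_exp (x := 0.7642 * 0.84) (y := 0.7642 * y)
    (by linarith)
  have h3 : gaussianTail (0.7642 * 0.84) ≤ 0.261 :=
    (strictAnti_gaussianTail.antitone (by norm_num)).trans gaussianTail_le_261
  refine h1.trans (h2.trans (mul_le_mul h3 (Real.exp_le_exp.2 ?_) (Real.exp_pos _).le
    (by norm_num)))
  nlinarith

/-- The first factor is bounded by a constant, the third by the tail at y times a factor of growth
rate about 0.08 in y², and the second decays at rate 0.29. The worst case is y = 0.84, with 0.39 ·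
0.261 · 1.152 < 1/6 - 1/50; the 1/50 is reserved for early selection. -/
lemma gaussianTail_triple_product_le {y : ℝ} (hy : 0.84 ≤ y) :
    gaussianTail (y / 3) * gaussianTail ((1 - √2 / 6) * y) * gaussianTail (11 / 12 * y) ≤
      (1 / 6 - 1 / 50) * gaussianTail y := by
  set s := y ^ 2 - 0.7056 with hs
  have hs0 : 0 ≤ s := by rw [hs]; nlinarith
  have hy2 : y ^ 2 = s + 0.7056 := by rw [hs]; ring
  have hA := gaussianTail_div_three_le hy
  have hB := gaussianTail_second_le_exp hy
  have hC := gaussianTail_third_le_mul hy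
  rw [← hs] at hB
  have hexp : Real.exp (23 / 288 * y ^ 2) ≤ 1.06 * Real.exp (0.08 * s) := by
    have h1 : Real.exp (0.0565 : ℝ) ≤ 1.06 := by
      have := Real.exp_bound_div_one_sub_of_interval (x := 0.0565) (by norm_num) (by norm_num)
      exact this.trans (by norm_num)
    calc Real.exp (23 / 288 * y ^ 2) ≤ Real.exp (0.0565 + 0.08 * s) := by
          apply Real.exp_le_exp.2
          rw [hy2]; linarith
      _ = Real.exp 0.0565 * Real.exp (0.08 * s) := Real.exp_add _ _
      _ ≤ _ := by gcongr
  have hD : gaussianTail (11 / 12 * y) ≤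
      gaussianTail y * ((1.152 + 0.09 * s) * Real.exp (0.08 * s)) := by
    refine hC.trans (mul_le_mul_of_nonneg_left ?_ (gaussianTail_nonneg y))
    have h1 : 1 ≤ Real.exp (0.08 * s) := Real.one_le_exp (by positivity)
    have h2 : (1 + y ^ 2) / 12 * Real.exp (23 / 288 * y ^ 2) ≤
        (1 + (s + 0.7056)) / 12 * (1.06 * Real.exp (0.08 * s)) := by
      rw [← hy2]; gcongr
    nlinarith
  have hE : Real.exp (-(0.29 * s)) * ((1.152 + 0.09 * s) * Real.exp (0.08 * s)) ≤ 1.152 := by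
    have h1 : Real.exp (-(0.29 * s)) * Real.exp (0.08 * s) = (Real.exp (0.21 * s))⁻¹ := by
      rw [← Real.exp_add, ← Real.exp_neg]; ring_nf
    have h2 : 0.21 * s + 1 ≤ Real.exp (0.21 * s) := Real.add_one_le_exp _
    calc _ = (1.152 + 0.09 * s) * (Real.exp (-(0.29 * s)) * Real.exp (0.08 * s)) := by ring
      _ = (1.152 + 0.09 * s) / Real.exp (0.21 * s) := by rw [h1, div_eq_mul_inv]
      _ ≤ 1.152 := by
        rw [div_le_iff₀ (Real.exp_pos _)]
        nlinarith
  have h39 : (0 : ℝ) ≤ 0.39 := by norm_num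
  have hB0 : (0 : ℝ) ≤ 0.261 * Real.exp (-(0.29 * s)) := by positivity
  calc _ ≤ 0.39 * (0.261 * Real.exp (-(0.29 * s))) *
        (gaussianTail y * ((1.152 + 0.09 * s) * Real.exp (0.08 * s))) := by
        gcongr <;> exact gaussianTail_nonneg _
    _ = 0.39 * 0.261 * gaussianTail y *
        (Real.exp (-(0.29 * s)) * ((1.152 + 0.09 * s) * Real.exp (0.08 * s))) := by ring
    _ ≤ 0.39 * 0.261 * gaussianTail y * 1.152 :=
        mul_le_mul_of_nonneg_left hE (mul_nonneg (by norm_num) (gaussianTail_nonneg y))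
    _ ≤ (1 / 6 - 1 / 50) * gaussianTail y := by
        have := gaussianTail_nonneg y
        norm_num
        nlinarith

/-- The Gaussian tail at `2 ^ l * y`, `l ≥ 2`, is geometrically small. -/
lemma gaussianTail_two_pow_mul_le {y : ℝ} (hy : 0.84 ≤ y) (l : ℕ) :
    gaussianTail (2 ^ (l + 2) * y) ≤ gaussianTail y / 100 * (1 / 2) ^ l := by
  induction l with
  | zero =>
    have h1 := gaussianTail_le_mul_exp (x := y) (y := 4 * y) (by linarith)
    -- The exponent is -7.5y², below -5 because y² ≥ 0.7056.
    have h2 : Real.exp (-((4 * y) ^ 2 - y ^ 2) / 2) ≤ 1 / 100 := by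
      have h3 : Real.exp (-((4 * y) ^ 2 - y ^ 2) / 2) ≤ Real.exp (-(5 : ℝ)) :=
        Real.exp_le_exp.2 (by nlinarith)
      have h4 : (100 : ℝ) ≤ Real.exp 5 := by
        have h5 : Real.exp 5 = Real.exp 1 ^ 5 := by rw [← Real.exp_nat_mul]; norm_num
        have h6 : (2.7 : ℝ) ≤ Real.exp 1 := by linarith [Real.exp_one_gt_d9]
        rw [h5]
        calc (100 : ℝ) ≤ 2.7 ^ 5 := by norm_num
          _ ≤ _ := by gcongr
      rw [Real.exp_neg] at h3
      refine h3.trans ?_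
      rw [one_div]
      gcongr
    have := mul_le_mul_of_nonneg_left h2 (gaussianTail_nonneg y)
    have h := h1.trans this
    norm_num at h ⊢
    linarith
  | succ l ih =>
    set w := 2 ^ (l + 2) * y with hw
    have hw1 : 1 ≤ w := by
      have : (4 : ℝ) ≤ 2 ^ (l + 2) := by
        rw [pow_add]; nlinarith [one_le_pow₀ (n := l) (one_le_two : (1 : ℝ) ≤ 2)]
      nlinarith
    have h1 := gaussianTail_le_mul_exp (x := w) (y := 2 * w) (by linarith)
    have h2 : Real.exp (-((2 * w) ^ 2 - w ^ 2) / 2) ≤ 1 / 2 := by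
      have h3 : Real.exp (-((2 * w) ^ 2 - w ^ 2) / 2) ≤ Real.exp (-(1 : ℝ)) :=
        Real.exp_le_exp.2 (by nlinarith)
      rw [Real.exp_neg] at h3
      refine h3.trans ?_
      rw [one_div]
      gcongr
      linarith [Real.add_one_le_exp (1 : ℝ)]
    have h4 := mul_le_mul_of_nonneg_left h2 (gaussianTail_nonneg w)
    have h5 : 2 ^ (l + 1 + 2) * y = 2 * w := by rw [hw]; ring
    rw [h5, pow_succ]
    linarith

/-! ### Symmetric averages of a convex function -/

/-- The average of `f` over `[-h, h]`. -/
noncomputable def symmAverage (f : ℝ → ℝ) (h : ℝ) : ℝ := 1 / 2 * ∫ u in (-1 : ℝ)..1, f (h * u)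

/-- Links the fixed-domain form, in which convexity can be integrated pointwise for several h at
once, to the integral appearing in the increments of Y. -/
lemma symmAverage_eq (f : ℝ → ℝ) {h : ℝ} (hh : h ≠ 0) :
    symmAverage f h = (2 * h)⁻¹ * ∫ u in (-h)..h, f u := by
  rw [symmAverage, intervalIntegral.integral_comp_mul_left f hh]
  simp
  ring

lemma convexOn_bounded {f : ℝ → ℝ} (hf : ConvexOn ℝ (Set.Icc (-1 / 2 : ℝ) (1 / 2)) f) :
    ∃ C, ∀ u ∈ Set.Icc (-1 / 2 : ℝ) (1 / 2), ‖f u‖ ≤ C := by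
  have hle : ∀ u ∈ Set.Icc (-1 / 2 : ℝ) (1 / 2), f u ≤ max (f (-1 / 2)) (f (1 / 2)) :=
    fun u hu => hf.le_max_of_mem_Icc (by norm_num) (by norm_num) hu
  set M := max (f (-1 / 2)) (f (1 / 2)) with hM
  -- The lower bound comes by reflection: f(u) ≥ 2f(0) - f(-u) ≥ 2f(0) - M.
  refine ⟨max M (M - 2 * f 0), fun u hu => ?_⟩
  have hu' : -u ∈ Set.Icc (-1 / 2 : ℝ) (1 / 2) := ⟨by linarith [hu.2], by linarith [hu.1]⟩
  have h1 := hf.2 hu hu' (by norm_num : (0 : ℝ) ≤ 1 / 2) (by norm_num : (0 : ℝ) ≤ 1 / 2)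
    (by norm_num)
  simp only [smul_eq_mul] at h1
  ring_nf at h1
  have h2 := hle u hu
  have h3 := hle _ hu'
  rw [Real.norm_eq_abs, abs_le]
  constructor
  · have := le_max_right M (M - 2 * f 0)
    linarith
  · exact h2.trans (le_max_left _ _)

lemma convexOn_integrableOn {f : ℝ → ℝ} (hf : ConvexOn ℝ (Set.Icc (-1 / 2 : ℝ) (1 / 2)) f) :
    IntegrableOn f (Set.Icc (-1 / 2 : ℝ) (1 / 2)) := by
  -- A convex function may jump at the endpoints, so continuity is available only in the interior.
  rw [integrableOn_Icc_iff_integrableOn_Ioo]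
  obtain ⟨C, hC⟩ := convexOn_bounded hf
  have hcont := hf.continuousOn_interior
  rw [interior_Icc] at hcont
  exact IntegrableOn.of_bound (by simp) (hcont.aestronglyMeasurable measurableSet_Ioo) C
    ((ae_restrict_iff' measurableSet_Ioo).2
      (Filter.Eventually.of_forall fun u hu => hC u (Set.Ioo_subset_Icc_self hu)))

lemma convexOn_intervalIntegrable_comp_mul
    {f : ℝ → ℝ} (hf : ConvexOn ℝ (Set.Icc (-1 / 2 : ℝ) (1 / 2)) f)
    {h : ℝ} (h0 : 0 ≤ h) (h1 : h ≤ 1 / 2) :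
    IntervalIntegrable (fun u => f (h * u)) volume (-1) 1 := by
  rcases h0.eq_or_lt with rfl | hpos
  · simp
  have hi : IntervalIntegrable f volume (-h) h := by
    rw [intervalIntegrable_iff_integrableOn_Icc_of_le (by linarith)]
    exact (convexOn_integrableOn hf).mono_set (Set.Icc_subset_Icc (by linarith) h1)
  have := hi.comp_mul_left (c := h)
  convert! this using 1 <;> field_simp

/-- Integrates 2f(hu/2) ≤ f(hu) + f(0); this makes the lower endpoint biased downwards. -/
lemma two_mul_symmAverage_half_sub_le
    {f : ℝ → ℝ} (hf : ConvexOn ℝ (Set.Icc (-1 / 2 : ℝ) (1 / 2)) f)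
    {h : ℝ} (h0 : 0 < h) (h1 : h ≤ 1 / 2) :
    2 * symmAverage f (h / 2) - symmAverage f h ≤ f 0 := by
  have hi1 := convexOn_intervalIntegrable_comp_mul hf (h := h / 2) (by linarith) (by linarith)
  have hi2 := convexOn_intervalIntegrable_comp_mul hf h0.le h1
  have : ∫ u in (-1 : ℝ)..1, (2 * f (h / 2 * u) - f (h * u)) ≤ ∫ u in (-1 : ℝ)..1, f 0 := by
    refine intervalIntegral.integral_mono_on (by norm_num) ((hi1.const_mul 2).sub hi2)
      (by simp) (fun u hu => ?_)
    have hu1 : h * u ∈ Set.Icc (-1 / 2 : ℝ) (1 / 2) := ⟨by nlinarith [hu.1], by nlinarith [hu.2]⟩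
    have := hf.2 hu1 (by norm_num : (0 : ℝ) ∈ Set.Icc (-1 / 2 : ℝ) (1 / 2))
      (by norm_num : (0 : ℝ) ≤ 1 / 2) (by norm_num : (0 : ℝ) ≤ 1 / 2) (by norm_num)
    simp only [smul_eq_mul, mul_zero, add_zero] at this
    rw [show 1 / 2 * (h * u) = h / 2 * u by ring] at this
    linarith
  rw [intervalIntegral.integral_sub (hi1.const_mul 2) hi2, intervalIntegral.integral_const_mul,
    intervalIntegral.integral_const] at this
  norm_num at this
  simp only [symmAverage]
  linarith

/-- Pairs u with -u under the integral; this makes the upper endpoint biased upwards. -/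
lemma le_symmAverage {f : ℝ → ℝ} (hf : ConvexOn ℝ (Set.Icc (-1 / 2 : ℝ) (1 / 2)) f)
    {h : ℝ} (h0 : 0 < h) (h1 : h ≤ 1 / 2) : f 0 ≤ symmAverage f h := by
  have hi := convexOn_intervalIntegrable_comp_mul hf h0.le h1
  have hi' : IntervalIntegrable (fun u => f (h * -u)) volume (-1) 1 := by
    have := hi.comp_mul_left (c := -1)
    convert! this.symm using 1 <;> simp
  have hneg : ∫ u in (-1 : ℝ)..1, f (h * -u) = ∫ u in (-1 : ℝ)..1, f (h * u) := by
    rw [intervalIntegral.integral_comp_neg (fun u => f (h * u))]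
    simp
  have : ∫ u in (-1 : ℝ)..1, 2 * f 0 ≤ ∫ u in (-1 : ℝ)..1, (f (h * u) + f (h * -u)) := by
    refine intervalIntegral.integral_mono_on (by norm_num) (by simp) (hi.add hi') (fun u hu => ?_)
    have hu1 : h * u ∈ Set.Icc (-1 / 2 : ℝ) (1 / 2) := ⟨by nlinarith [hu.1], by nlinarith [hu.2]⟩
    have hu2 : h * -u ∈ Set.Icc (-1 / 2 : ℝ) (1 / 2) := ⟨by nlinarith [hu.2], by nlinarith [hu.1]⟩
    have := hf.2 hu1 hu2 (by norm_num : (0 : ℝ) ≤ 1 / 2) (by norm_num : (0 : ℝ) ≤ 1 / 2)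
      (by norm_num)
    simp only [smul_eq_mul] at this
    rw [show 1 / 2 * (h * u) + 1 / 2 * (h * -u) = 0 by ring] at this
    linarith
  rw [intervalIntegral.integral_add hi hi', hneg, intervalIntegral.integral_const] at this
  norm_num at this
  simp only [symmAverage]
  linarith

/-- Since h/2 = (1/3)h + (2/3)(h/4), convexity gives 3f(hu/2) ≤ f(hu) + 2f(hu/4), and integration
gives the halving of the differences. -/
lemma symmAverage_sub_half_le {f : ℝ → ℝ} (hf : ConvexOn ℝ (Set.Icc (-1 / 2 : ℝ) (1 / 2)) f)
    {h : ℝ} (h0 : 0 < h) (h1 : h ≤ 1 / 2) :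
    symmAverage f (h / 2) - symmAverage f (h / 4) ≤
      (symmAverage f h - symmAverage f (h / 2)) / 2 := by
  have hi1 := convexOn_intervalIntegrable_comp_mul hf h0.le h1
  have hi2 := convexOn_intervalIntegrable_comp_mul hf (h := h / 2) (by linarith) (by linarith)
  have hi3 := convexOn_intervalIntegrable_comp_mul hf (h := h / 4) (by linarith) (by linarith)
  have : ∫ u in (-1 : ℝ)..1, 3 * f (h / 2 * u) ≤
      ∫ u in (-1 : ℝ)..1, (f (h * u) + 2 * f (h / 4 * u)) := by
    refine intervalIntegral.integral_mono_on (by norm_num) (hi2.const_mul 3)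
      (hi1.add (hi3.const_mul 2)) (fun u hu => ?_)
    have hu1 : h * u ∈ Set.Icc (-1 / 2 : ℝ) (1 / 2) := ⟨by nlinarith [hu.1], by nlinarith [hu.2]⟩
    have hu2 : h / 4 * u ∈ Set.Icc (-1 / 2 : ℝ) (1 / 2) :=
      ⟨by nlinarith [hu.1], by nlinarith [hu.2]⟩
    have := hf.2 hu1 hu2 (by norm_num : (0 : ℝ) ≤ 1 / 3) (by norm_num : (0 : ℝ) ≤ 2 / 3)
      (by norm_num)
    simp only [smul_eq_mul] at this
    rw [show 1 / 3 * (h * u) + 2 / 3 * (h / 4 * u) = h / 2 * u by ring] at this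
    linarith
  rw [intervalIntegral.integral_add hi1 (hi3.const_mul 2), intervalIntegral.integral_const_mul,
    intervalIntegral.integral_const_mul] at this
  simp only [symmAverage]
  linarith

/-! ### The noise of the local averages -/

/-- Only increments of W are specified, so W is recentred at -1/2 to start at 0. Independent
Gaussian increments then make it a Gaussian process, and the covariance is the variance at the
earlier time. -/
lemma isBrownian_gaussian_cov {Ω : Type*} [MeasurableSpace Ω] {P : Measure Ω}
    [IsProbabilityMeasure P] {W : ℝ → Ω → ℝ} (hW : IsBrownianOnInterval W P) :
    IsGaussianProcess (fun (t : Set.Icc (-1 / 2 : ℝ) (1 / 2)) ω => W t ω - W (-1 / 2) ω) P ∧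
    (∀ t : Set.Icc (-1 / 2 : ℝ) (1 / 2), P[fun ω => W t ω - W (-1 / 2) ω] = 0) ∧
    ∀ s t : Set.Icc (-1 / 2 : ℝ) (1 / 2), s ≤ t →
      cov[fun ω => W s ω - W (-1 / 2) ω, fun ω => W t ω - W (-1 / 2) ω; P] = s + 1 / 2 := by
  have : Fact ((-1 / 2 : ℝ) ≤ 1 / 2) := ⟨by norm_num⟩
  have hbot : ((⊥ : Set.Icc (-1 / 2 : ℝ) (1 / 2)) : ℝ) = -1 / 2 := rfl
  have hmem : (-1 / 2 : ℝ) ∈ Set.Icc (-1 / 2 : ℝ) (1 / 2) := by norm_num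
  have hlaw : ∀ t : Set.Icc (-1 / 2 : ℝ) (1 / 2), HasLaw (fun ω => W t ω - W (-1 / 2) ω)
      (gaussianReal 0 (t - -1 / 2 : ℝ).toNNReal) P :=
    fun t => hW.law_increments _ hmem _ t.2 t.2.1
  have hinc : HasIndepIncrements
      (fun (t : Set.Icc (-1 / 2 : ℝ) (1 / 2)) ω => W t ω - W (-1 / 2) ω) P := by
    intro n t ht
    have := hW.indep_increments n t ht
    simpa using this
  have hG : IsGaussianProcess
      (fun (t : Set.Icc (-1 / 2 : ℝ) (1 / 2)) ω => W t ω - W (-1 / 2) ω) P :=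
    HasIndepIncrements.isGaussianProcess (fun t => (hlaw t).hasGaussianLaw)
      (by simp [hbot]) hinc
  refine ⟨hG, fun t => ?_, fun s t hst => ?_⟩
  · rw [(hlaw t).integral_eq]; exact integral_id_gaussianReal
  · have hs2 := (hG.hasGaussianLaw_eval s).memLp_two
    have ht2 := (hG.hasGaussianLaw_eval t).memLp_two
    have hind := hinc.indepFun_eval_sub bot_le hst (by simp [hbot])
    have h0 := hind.covariance_eq_zero hs2 (ht2.sub hs2)
    have h1 := covariance_sub_right (μ := P) hs2 ht2 hs2
    rw [h0, covariance_self hs2.aemeasurable] at h1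
    have h2 := (hlaw s).variance_eq
    rw [variance_id_gaussianReal, Real.coe_toNNReal _ (by linarith [s.2.1])] at h2
    linarith

lemma half_pow_mem (k : ℕ) : (1 / 2 : ℝ) ^ (k + 1) ∈ Set.Icc (-1 / 2 : ℝ) (1 / 2) := by
  refine ⟨by linarith [pow_pos (by norm_num : (0 : ℝ) < 1 / 2) (k + 1)], ?_⟩
  rw [pow_succ]
  linarith [pow_le_one₀ (n := k) (by norm_num : (0 : ℝ) ≤ 1 / 2) (by norm_num)]

lemma neg_half_pow_mem (k : ℕ) : -(1 / 2 : ℝ) ^ (k + 1) ∈ Set.Icc (-1 / 2 : ℝ) (1 / 2) :=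
  ⟨by linarith [(half_pow_mem k).2], by linarith [(half_pow_mem k).1]⟩

/-- The symmetric increments of a Brownian motion over the dyadic intervals around `0`. -/
lemma isBrownian_symmetric_increments {Ω : Type*} [MeasurableSpace Ω] {P : Measure Ω}
    [IsProbabilityMeasure P] {W : ℝ → Ω → ℝ} (hW : IsBrownianOnInterval W P) :
    IsGaussianProcess (fun (k : ℕ) ω => W ((1 / 2) ^ (k + 1)) ω - W (-(1 / 2) ^ (k + 1)) ω) P ∧
    (∀ k : ℕ, P[fun ω => W ((1 / 2) ^ (k + 1)) ω - W (-(1 / 2) ^ (k + 1)) ω] = 0) ∧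
    ∀ i j : ℕ, i ≤ j →
      cov[fun ω => W ((1 / 2) ^ (i + 1)) ω - W (-(1 / 2) ^ (i + 1)) ω,
        fun ω => W ((1 / 2) ^ (j + 1)) ω - W (-(1 / 2) ^ (j + 1)) ω; P] = (1 / 2) ^ j := by
  obtain ⟨hG, hmean, hcov⟩ := isBrownian_gaussian_cov hW
  set B : Set.Icc (-1 / 2 : ℝ) (1 / 2) → Ω → ℝ := fun t ω => W t ω - W (-1 / 2) ω with hB
  let p : ℕ → Set.Icc (-1 / 2 : ℝ) (1 / 2) := fun k => ⟨_, half_pow_mem k⟩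
  let q : ℕ → Set.Icc (-1 / 2 : ℝ) (1 / 2) := fun k => ⟨_, neg_half_pow_mem k⟩
  have hX : ∀ k : ℕ, (fun ω => W ((1 / 2) ^ (k + 1)) ω - W (-(1 / 2) ^ (k + 1)) ω) =
      B (p k) - B (q k) := by
    intro k; ext ω; simp [hB, p, q]
  have hint := fun t => (hG.hasGaussianLaw_eval t).integrable
  have h2 := fun t => (hG.hasGaussianLaw_eval t).memLp_two
  refine ⟨?_, fun k => ?_, fun i j hij => ?_⟩
  · classical
    refine hG.of_isGaussianProcess fun k => ⟨{p k, q k},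
      { toFun := fun x => x ⟨p k, by simp⟩ - x ⟨q k, by simp⟩
        map_add' := fun x y => by simp; abel
        map_smul' := fun c x => by simp; ring
        cont := by fun_prop }, fun ω => ?_⟩
    exact congrFun (hX k) ω
  · have hmean' : ∀ t, ∫ ω, B t ω ∂P = 0 := hmean
    rw [hX k]
    refine (integral_sub (hint (p k)) (hint (q k))).trans ?_
    rw [hmean', hmean', sub_zero]
  -- The intervals are nested, so the covariance is the length of the inner one; the four orderings
  -- below select the earlier time in each term.
  · have hle : (1 / 2 : ℝ) ^ (j + 1) ≤ (1 / 2) ^ (i + 1) :=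
      pow_le_pow_of_le_one (by norm_num) (by norm_num) (by omega)
    have hpos : (0 : ℝ) < (1 / 2) ^ (j + 1) := by positivity
    have hpp : p j ≤ p i := hle
    have hqq : q i ≤ q j := neg_le_neg hle
    have hqp : q j ≤ p i := Subtype.coe_le_coe.1 (by simp only [p, q]; linarith)
    have hqp' : q i ≤ p j := Subtype.coe_le_coe.1 (by simp only [p, q]; linarith)
    rw [hX i, hX j, covariance_sub_sub (h2 _) (h2 _) (h2 _) (h2 _),
      covariance_comm (B (p i)) (B (p j)), covariance_comm (B (p i)) (B (q j))]
    simp only [hB]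
    rw [hcov _ _ hpp, hcov _ _ hqp, hcov _ _ hqp', hcov _ _ hqq]
    simp only [p, q]
    ring

lemma delta_succ (y : ℝ → ℝ) (k : ℕ) :
    delta y (k + 1) = 2 ^ k * (y ((1 / 2) ^ (k + 1)) - y (-(1 / 2) ^ (k + 1))) := by
  have h1 : (2 : ℝ) ^ (((k + 1 : ℕ) : ℤ) - 1) = 2 ^ k := by
    push_cast; rw [add_sub_cancel_right, zpow_natCast]
  have h2 : (2 : ℝ) ^ (-((k + 1 : ℕ) : ℤ)) = (1 / 2) ^ (k + 1) := by
    rw [zpow_neg, zpow_natCast, one_div, inv_pow]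
  rw [delta, h1, h2]

/-- The local averages in the white noise model are symmetric averages of `f` plus Gaussian noise
with independent increments in the level. -/
lemma exists_noise {Ω : Type*} [MeasurableSpace Ω] {P : Measure Ω} [IsProbabilityMeasure P]
    {Y : ℝ → Ω → ℝ} {f : ℝ → ℝ} {n : ℝ} (hn : 0 < n) (hY : IsWhiteNoiseObservation Y f n P) :
    ∃ ξ : ℕ → Ω → ℝ, IsGaussianProcess ξ P ∧ (∀ k, P[ξ k] = 0) ∧
      (∀ i j, i ≤ j → cov[ξ i, ξ j; P] = 2 ^ i / n) ∧
      ∀ᵐ ω ∂P, ∀ k, delta (fun t => Y t ω) (k + 1) =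
        symmAverage f ((1 / 2) ^ (k + 1)) + ξ k ω := by
  obtain ⟨W, hW, hYW⟩ := hY
  obtain ⟨hG, hmean, hcov⟩ := isBrownian_symmetric_increments hW
  refine ⟨fun k ω => (2 ^ k * (√n)⁻¹) •
    (W ((1 / 2) ^ (k + 1)) ω - W (-(1 / 2) ^ (k + 1)) ω), hG.smul _, fun k => ?_,
    fun i j hij => ?_, ?_⟩
  · simp only [smul_eq_mul]
    rw [integral_const_mul, hmean k, mul_zero]
  · simp only [smul_eq_mul]
    rw [covariance_const_mul_left, covariance_const_mul_right, hcov i j hij]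
    have h1 : (√n)⁻¹ * (√n)⁻¹ = n⁻¹ := by rw [← mul_inv, Real.mul_self_sqrt hn.le]
    have h2 : (2 : ℝ) ^ j * (1 / 2) ^ j = 1 := by rw [← mul_pow]; norm_num
    calc _ = 2 ^ i * ((√n)⁻¹ * (√n)⁻¹) * ((2 : ℝ) ^ j * (1 / 2) ^ j) := by ring
      _ = _ := by rw [h1, h2, mul_one, div_eq_mul_inv]
  · filter_upwards [hYW] with ω hω k
    have h := hω _ (neg_half_pow_mem k) _ (half_pow_mem k)
    have h2 : (2 * (1 / 2 : ℝ) ^ (k + 1))⁻¹ = 2 ^ k := by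
      rw [pow_succ, one_div, inv_pow]; field_simp
    rw [delta_succ, h, symmAverage_eq f (by positivity), h2, smul_eq_mul]
    ring

/-! ### Distributional facts on the statistics -/

lemma sigma_succ (n : ℝ) (k : ℕ) : sigma n (k + 1) = √(2 ^ k / n) := by
  rw [sigma]
  push_cast
  rw [add_sub_cancel_right, zpow_natCast]

lemma sigma_pos {n : ℝ} (hn : 0 < n) (j : ℕ) : 0 < sigma n j := by
  rw [sigma]; positivity

lemma sigma_sq {n : ℝ} (hn : 0 < n) (k : ℕ) : sigma n (k + 1) ^ 2 = 2 ^ k / n := by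
  rw [sigma_succ, Real.sq_sqrt (by positivity)]

lemma sigma_add_one (n : ℝ) (j : ℕ) : sigma n (j + 1) = √2 * sigma n j := by
  rw [sigma, sigma, ← Real.sqrt_mul (by norm_num)]
  push_cast
  rw [add_sub_right_comm, zpow_add_one₀ two_ne_zero]
  ring_nf

lemma sigma_add (n : ℝ) (j l : ℕ) : sigma n (j + l) = √2 ^ l * sigma n j := by
  induction l with
  | zero => simp
  | succ l ih => rw [← add_assoc, sigma_add_one, ih, pow_succ]; ring

lemma sigma_mono {n : ℝ} (hn : 0 < n) : Monotone (sigma n) :=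
  monotone_nat_of_le_succ fun j => by
    rw [sigma_add_one]
    exact le_mul_of_one_le_left (sigma_pos hn j).le (Real.le_sqrt_of_sq_le (by norm_num))

section

variable {Ω : Type*} [MeasurableSpace Ω] {P : Measure Ω}

lemma hasLaw_standard_of_hasGaussianLaw {X : Ω → ℝ} (hX : HasGaussianLaw X P) {m s : ℝ}
    (hs : 0 < s) (hm : P[X] = m) (hv : Var[X; P] = s ^ 2) :
    HasLaw (fun ω => (X ω - m) / s) (gaussianReal 0 1) P := by
  have h1 : HasLaw X (gaussianReal m (s ^ 2).toNNReal) P :=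
    ⟨hX.aemeasurable, by rw [hX.map_eq_gaussianReal, hm, hv]⟩
  have h2 := gaussianReal_div_const (gaussianReal_sub_const h1 m) s
  convert! h2 using 2
  · simp
  · ext
    rw [NNReal.coe_div, Real.coe_toNNReal _ (sq_nonneg s)]
    simp
    rw [div_self (by positivity)]

lemma measureReal_lt_eq_gaussianTail [IsProbabilityMeasure P] {X : Ω → ℝ}
    (hX : HasGaussianLaw X P) {m s : ℝ} (hs : 0 < s) (hm : P[X] = m) (hv : Var[X; P] = s ^ 2) (c : ℝ) :
    P.real {ω | c < X ω} = gaussianTail ((c - m) / s) := by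
  have h := (hasLaw_standard_of_hasGaussianLaw hX hs hm hv).measureReal_eq
    (p := fun x => (c - m) / s < x) measurableSet_Ioi
  rw [← gaussianReal_Ioi]
  convert! h using 3
  ext ω
  rw [div_lt_div_iff_of_pos_right hs, sub_lt_sub_iff_right]

lemma measureReal_gt_eq_gaussianTail [IsProbabilityMeasure P] {X : Ω → ℝ}
    (hX : HasGaussianLaw X P) {m s : ℝ} (hs : 0 < s) (hm : P[X] = m) (hv : Var[X; P] = s ^ 2) (c : ℝ) :
    P.real {ω | X ω < c} = gaussianTail ((m - c) / s) := by
  have h := measureReal_lt_eq_gaussianTail (X := -X) hX.neg (m := -m) hs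
    (by simp only [Pi.neg_apply]; rw [integral_neg, hm])
    (by rw [variance_neg, hv]) (-c)
  simp only [Pi.neg_apply, neg_lt_neg_iff] at h
  rw [h]
  ring_nf

lemma measureReal_le_eq_gaussianTail {X : Ω → ℝ} (hX : HasGaussianLaw X P) {m s : ℝ}
    (hs : 0 < s) (hm : P[X] = m) (hv : Var[X; P] = s ^ 2) (c : ℝ) :
    P.real {ω | X ω ≤ c} = gaussianTail ((m - c) / s) := by
  have h := (hasLaw_standard_of_hasGaussianLaw hX hs hm hv).measureReal_eq
    (p := fun x => x ≤ (c - m) / s) measurableSet_Iic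
  have h2 : (m - c) / s = -((c - m) / s) := by ring
  rw [h2, gaussianTail_neg, gaussianTail, sub_sub_cancel, cdf_eq_real]
  convert! h using 3
  ext ω
  rw [div_le_div_iff_of_pos_right hs, sub_le_sub_iff_right]

/-- The covariance depends only on the smaller index, so distinct consecutive differences are
uncorrelated; joint Gaussianity upgrades this to independence. -/
lemma iIndepFun_noise_sub [IsProbabilityMeasure P] {ξ : ℕ → Ω → ℝ} {n : ℝ}
    (hG : IsGaussianProcess ξ P)
    (hcov : ∀ i j, i ≤ j → cov[ξ i, ξ j; P] = 2 ^ i / n) :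
    iIndepFun (fun k => ξ k - ξ (k + 1)) P := by
  have hη : IsGaussianProcess (fun k => ξ k - ξ (k + 1)) P := by
    refine hG.of_isGaussianProcess fun k => ⟨{k, k + 1},
      { toFun := fun x => x ⟨k, by simp⟩ - x ⟨k + 1, by simp⟩
        map_add' := fun x y => by simp; abel
        map_smul' := fun c x => by simp; ring
        cont := by fun_prop }, fun ω => ?_⟩
    rfl
  have h2 := fun k => (hG.hasGaussianLaw_eval k).memLp_two
  have key : ∀ i j, i < j → cov[ξ i - ξ (i + 1), ξ j - ξ (j + 1); P] = 0 := by
    intro i j hij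
    rw [covariance_sub_sub (h2 _) (h2 _) (h2 _) (h2 _), hcov _ _ hij.le,
      hcov i (j + 1) (by omega), hcov (i + 1) j (by omega), hcov (i + 1) (j + 1) (by omega)]
    ring
  refine iIndepFun_iff_finset.2 fun s => ?_
  refine HasGaussianLaw.iIndepFun_of_covariance_eq_zero (hη.hasGaussianLaw s) fun i j hij => ?_
  rcases lt_or_gt_of_ne (fun h => hij (Subtype.ext h) : (i : ℕ) ≠ j) with h | h
  · exact key i j h
  · rw [covariance_comm]; exact key j i h

end

lemma symmAverage_dyadic_halving {f : ℝ → ℝ}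
    (hf : ConvexOn ℝ (Set.Icc (-1 / 2 : ℝ) (1 / 2)) f) (k : ℕ) :
    symmAverage f ((1 / 2) ^ (k + 2)) - symmAverage f ((1 / 2) ^ (k + 3)) ≤
      (symmAverage f ((1 / 2) ^ (k + 1)) - symmAverage f ((1 / 2) ^ (k + 2))) / 2 := by
  have := symmAverage_sub_half_le hf (by positivity : (0 : ℝ) < (1 / 2) ^ (k + 1))
    (half_pow_mem k).2
  rw [show (1 / 2 : ℝ) ^ (k + 1) / 2 = (1 / 2) ^ (k + 2) by ring,
    show (1 / 2 : ℝ) ^ (k + 1) / 4 = (1 / 2) ^ (k + 3) by ring] at this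
  exact this

lemma T_mean_variance {Ω : Type*} [MeasurableSpace Ω] {P : Measure Ω} [IsProbabilityMeasure P]
    {Y : ℝ → Ω → ℝ} {f : ℝ → ℝ} {n : ℝ} (hn : 0 < n) (hY : IsWhiteNoiseObservation Y f n P)
    (k : ℕ) :
    HasGaussianLaw (fun ω => T (fun t => Y t ω) (k + 1)) P ∧
    ∫ ω, T (fun t => Y t ω) (k + 1) ∂P =
      symmAverage f ((1 / 2) ^ (k + 1)) - symmAverage f ((1 / 2) ^ (k + 2)) ∧
    Var[fun ω => T (fun t => Y t ω) (k + 1); P] = sigma n (k + 1) ^ 2 := by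
  obtain ⟨ξ, hG, hmean, hcov, hD⟩ := exists_noise hn hY
  have hi := fun i => (hG.hasGaussianLaw_eval i).integrable
  have h2 := fun i => (hG.hasGaussianLaw_eval i).memLp_two
  set d := symmAverage f ((1 / 2) ^ (k + 1)) - symmAverage f ((1 / 2) ^ (k + 2)) with hd
  have hη : HasGaussianLaw (ξ k - ξ (k + 1)) P := hG.hasGaussianLaw_sub
  have hlaw : HasLaw (ξ k - ξ (k + 1)) (gaussianReal 0 (sigma n (k + 1) ^ 2).toNNReal) P := by
    refine ⟨hη.aemeasurable, ?_⟩
    rw [hη.map_eq_gaussianReal]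
    congr 2
    · refine (integral_sub (hi k) (hi (k + 1))).trans ?_
      rw [hmean, hmean, sub_zero]
    · rw [variance_sub (h2 k) (h2 (k + 1)), ← covariance_self (h2 k).aemeasurable,
        ← covariance_self (h2 (k + 1)).aemeasurable, hcov _ _ le_rfl, hcov _ _ le_rfl,
        hcov k (k + 1) (by omega), sigma_sq hn]
      ring
  have hT : HasLaw (fun ω => T (fun t => Y t ω) (k + 1))
      (gaussianReal d (sigma n (k + 1) ^ 2).toNNReal) P := by
    have h := gaussianReal_const_add hlaw d
    rw [zero_add] at h
    refine h.congr ?_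
    filter_upwards [hD] with ω hω
    rw [T, hω, hω (k + 1), hd, Pi.sub_apply]
    ring
  refine ⟨hT.hasGaussianLaw, ?_, ?_⟩
  · rw [hT.integral_eq]; exact integral_id_gaussianReal
  · rw [hT.variance_eq, variance_id_gaussianReal, Real.coe_toNNReal _ (sq_nonneg _)]

lemma iIndepFun_T {Ω : Type*} [MeasurableSpace Ω] {P : Measure Ω} [IsProbabilityMeasure P]
    {Y : ℝ → Ω → ℝ} {f : ℝ → ℝ} {n : ℝ} (hn : 0 < n) (hY : IsWhiteNoiseObservation Y f n P) :
    iIndepFun (fun k ω => T (fun t => Y t ω) (k + 1)) P := by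
  obtain ⟨ξ, hG, hmean, hcov, hD⟩ := exists_noise hn hY
  have h := (iIndepFun_noise_sub hG hcov).comp
    (fun k x => symmAverage f ((1 / 2) ^ (k + 1)) - symmAverage f ((1 / 2) ^ (k + 2)) + x)
    (fun k => by fun_prop)
  refine h.congr fun k => ?_
  filter_upwards [hD] with ω hω
  rw [T, hω, hω (k + 1)]
  simp only [Function.comp_apply, Pi.sub_apply]
  ring

/-- Each interval `CI_j(a)` covers `f 0` with probability at least `1 - a`. -/
lemma measureReal_notMem_CI_le {Ω : Type*} [MeasurableSpace Ω] {P : Measure Ω}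
    [IsProbabilityMeasure P] {Y : ℝ → Ω → ℝ} {f : ℝ → ℝ} {n : ℝ} (hn : 0 < n)
    (hf : ConvexOn ℝ (Set.Icc (-1 / 2 : ℝ) (1 / 2)) f)
    (hY : IsWhiteNoiseObservation Y f n P) {a : ℝ} (ha0 : 0 < a) (ha1 : a < 1) (k : ℕ) :
    P.real {ω | f 0 ∉ CI n a (fun t => Y t ω) (k + 1)} ≤ a := by
  obtain ⟨ξ, hG, hmean, hcov, hD⟩ := exists_noise hn hY
  have hi := fun i => (hG.hasGaussianLaw_eval i).integrable
  have h2 := fun i => (hG.hasGaussianLaw_eval i).memLp_two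
  have hz := gaussianTail_z (a := a / 2) (by linarith) (by linarith)
  set d := fun i : ℕ => symmAverage f ((1 / 2) ^ (i + 1)) with hd
  set x := z (a / 2) with hx
  have hs := sigma_pos hn (k + 1)
  have hs' := sigma_pos hn (k + 1 + 1)
  have hdmono : 2 * d (k + 1) - d k ≤ f 0 := by
    have := two_mul_symmAverage_half_sub_le hf (by positivity : (0 : ℝ) < (1 / 2) ^ (k + 1))
      (half_pow_mem k).2
    rw [show (1 / 2 : ℝ) ^ (k + 1) / 2 = (1 / 2) ^ (k + 1 + 1) by ring] at this
    exact this
  have hdle : f 0 ≤ d (k + 1) := le_symmAverage hf (by positivity) (half_pow_mem (k + 1)).2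
  have hL : P.real {ω | f 0 - (2 * d (k + 1) - d k) + x * √5 * sigma n (k + 1) <
      ((2 : ℝ) • ξ (k + 1) - ξ k) ω} ≤ a / 2 := by
    have hX : HasGaussianLaw ((2 : ℝ) • ξ (k + 1) - ξ k) P := by
      refine ((hG.hasGaussianLaw_prodMk (s := k + 1) (t := k)).map
        ((2 : ℝ) • ContinuousLinearMap.fst ℝ ℝ ℝ - ContinuousLinearMap.snd ℝ ℝ ℝ)).congr ?_
      exact Filter.Eventually.of_forall fun ω => by simp
    rw [measureReal_lt_eq_gaussianTail hX (m := 0) (s := √5 * sigma n (k + 1)) (by positivity),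
      ← hz]
    · refine strictAnti_gaussianTail.antitone ?_
      rw [sub_zero, le_div_iff₀ (by positivity)]
      linarith
    · refine (integral_sub ((hi (k + 1)).smul (2 : ℝ)) (hi k)).trans ?_
      simp only [Pi.smul_apply]
      rw [integral_smul, hmean, hmean]; simp
    -- Source of √5: in units of 2^k / n the variance is 4 · 2 + 1 - 4 = 5.
    · rw [variance_sub ((h2 (k + 1)).const_smul _) (h2 k), variance_smul, covariance_smul_left,
        ← covariance_self (h2 k).aemeasurable, ← covariance_self (h2 (k + 1)).aemeasurable,
        hcov _ _ le_rfl, hcov _ _ le_rfl, covariance_comm, hcov k (k + 1) (by omega), mul_pow,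
        sigma_sq hn, Real.sq_sqrt (by norm_num)]
      ring
  have hR : P.real {ω | ξ (k + 1) ω < f 0 - d (k + 1) - x * sigma n (k + 1 + 1)} ≤ a / 2 := by
    rw [measureReal_gt_eq_gaussianTail (hG.hasGaussianLaw_eval (k + 1)) (m := 0) hs' (hmean _),
      ← hz]
    · refine strictAnti_gaussianTail.antitone ?_
      rw [le_div_iff₀ hs']
      linarith
    · rw [← covariance_self (h2 (k + 1)).aemeasurable, hcov _ _ le_rfl, sigma_sq hn]
  have hsub : ({ω | f 0 ∉ CI n a (fun t => Y t ω) (k + 1)} : Set Ω) ≤ᵐ[P]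
      ({ω | f 0 - (2 * d (k + 1) - d k) + x * √5 * sigma n (k + 1) <
        ((2 : ℝ) • ξ (k + 1) - ξ k) ω} ∪
        {ω | ξ (k + 1) ω < f 0 - d (k + 1) - x * sigma n (k + 1 + 1)} : Set Ω) := by
    filter_upwards [hD] with ω hω hmem
    have hmem' : f 0 ∉ CI n a (fun t => Y t ω) (k + 1) := hmem
    rw [CI, hω (k + 1), hω k, Set.mem_Icc, not_and_or, not_le, not_le] at hmem'
    rcases hmem' with h | h
    · left
      show _ < 2 * ξ (k + 1) ω - ξ k ω
      simp only [hd]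
      linarith
    · right
      show ξ (k + 1) ω < f 0 - d (k + 1) - x * sigma n (k + 1 + 1)
      simp only [hd]
      linarith
  calc P.real {ω | f 0 ∉ CI n a (fun t => Y t ω) (k + 1)} ≤ _ :=
        ENNReal.toReal_mono (measure_ne_top _ _) (measure_mono_ae hsub)
    _ ≤ a / 2 + a / 2 := (measureReal_union_le _ _).trans (add_le_add hL hR)
    _ = a := by ring

/-! ### The benchmark index and the selected index -/

lemma jStar_mem {Ω : Type*} [MeasurableSpace Ω] {P : Measure Ω} {Y : ℝ → Ω → ℝ} {n α : ℝ}
    (h : (oracleSet n α Y P).Nonempty) : jStar n α Y P ∈ oracleSet n α Y P :=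
  Nat.sInf_mem h

/-- The event that the first `N` levels from the benchmark index on all exceed the threshold. -/
def exceedEvent {Ω : Type*} (n α : ℝ) (Y : ℝ → Ω → ℝ) (J N : ℕ) : Set Ω :=
  ⋂ l ∈ Finset.range N, {ω | z α * sigma n (J + l) < T (fun t => Y t ω) (J + l)}

lemma mem_exceedEvent_of_le_jHat {Ω : Type*} {Y : ℝ → Ω → ℝ} {n α : ℝ} {J N : ℕ}
    (hJ : 1 ≤ J) {ω : Ω}
    (h : J + N ≤ jHat n α (fun t => Y t ω)) : ω ∈ exceedEvent n α Y J N := by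
  simp only [exceedEvent, Set.mem_iInter, Finset.mem_range]
  intro l hl
  by_contra hcon
  have : J + l ∉ selectable n α (fun t => Y t ω) :=
    Nat.notMem_of_lt_sInf (by rw [jHat] at h; omega)
  exact this ⟨by omega, not_lt.1 hcon⟩

section

variable {Ω : Type*} [MeasurableSpace Ω] {P : Measure Ω} [IsProbabilityMeasure P]
  {Y : ℝ → Ω → ℝ} {f : ℝ → ℝ} {n : ℝ} {α : ℝ}

lemma integral_T_succ_le (hn : 0 < n) (hf : ConvexOn ℝ (Set.Icc (-1 / 2 : ℝ) (1 / 2)) f)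
    (hY : IsWhiteNoiseObservation Y f n P) {j : ℕ} (hj : 1 ≤ j) :
    ∫ ω, T (fun t => Y t ω) (j + 1) ∂P ≤ (∫ ω, T (fun t => Y t ω) j ∂P) / 2 := by
  obtain ⟨k, rfl⟩ := Nat.exists_eq_add_of_le' hj
  rw [(T_mean_variance hn hY k).2.1, (T_mean_variance hn hY (k + 1)).2.1]
  exact symmAverage_dyadic_halving hf k

lemma integral_T_add_le (hn : 0 < n) (hf : ConvexOn ℝ (Set.Icc (-1 / 2 : ℝ) (1 / 2)) f)
    (hY : IsWhiteNoiseObservation Y f n P) {j : ℕ} (hj : 1 ≤ j) (l : ℕ) :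
    2 ^ l * ∫ ω, T (fun t => Y t ω) (j + l) ∂P ≤ ∫ ω, T (fun t => Y t ω) j ∂P := by
  induction l with
  | zero => simp
  | succ l ih =>
    have := integral_T_succ_le hn hf hY (j := j + l) (by omega)
    have h2 := mul_le_mul_of_nonneg_left this (by positivity : (0 : ℝ) ≤ 2 ^ (l + 1))
    refine le_trans h2 (le_trans (le_of_eq ?_) ih)
    ring

lemma measureReal_lt_T (hn : 0 < n) (hY : IsWhiteNoiseObservation Y f n P) {j : ℕ}
    (hj : 1 ≤ j) (c : ℝ) : P.real {ω | c < T (fun t => Y t ω) j} =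
      gaussianTail ((c - ∫ ω, T (fun t => Y t ω) j ∂P) / sigma n j) := by
  obtain ⟨k, rfl⟩ := Nat.exists_eq_add_of_le' hj
  have h := T_mean_variance hn hY k
  exact measureReal_lt_eq_gaussianTail h.1 (sigma_pos hn _) rfl h.2.2 c

lemma measureReal_T_le (hn : 0 < n) (hY : IsWhiteNoiseObservation Y f n P) {j : ℕ}
    (hj : 1 ≤ j) (c : ℝ) : P.real {ω | T (fun t => Y t ω) j ≤ c} =
      gaussianTail (((∫ ω, T (fun t => Y t ω) j ∂P) - c) / sigma n j) := by
  obtain ⟨k, rfl⟩ := Nat.exists_eq_add_of_le' hj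
  have h := T_mean_variance hn hY k
  exact measureReal_le_eq_gaussianTail h.1 (sigma_pos hn _) rfl h.2.2 c

/-- At level 1 + l the mean is at most 2^(-l) times the mean at level 1, while the threshold does
not decrease. -/
lemma oracleSet_nonempty (hn : 0 < n) (hf : ConvexOn ℝ (Set.Icc (-1 / 2 : ℝ) (1 / 2)) f)
    (hY : IsWhiteNoiseObservation Y f n P) (hz : 0 < z α) : (oracleSet n α Y P).Nonempty := by
  set m := ∫ ω, T (fun t => Y t ω) 1 ∂P with hm
  have hpos : 0 < 2 / 3 * z α * sigma n 1 := by have := sigma_pos hn 1; positivity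
  obtain ⟨l, hl⟩ := pow_unbounded_of_one_lt (m / (2 / 3 * z α * sigma n 1)) one_lt_two
  rw [div_lt_iff₀ hpos] at hl
  refine ⟨1 + l, by omega, ?_⟩
  have h1 := integral_T_add_le hn hf hY le_rfl l
  have h2 : 2 / 3 * z α * sigma n 1 ≤ 2 / 3 * z α * sigma n (1 + l) :=
    mul_le_mul_of_nonneg_left (sigma_mono hn (by omega)) (by positivity)
  refine le_trans ?_ h2
  have h3 : (0 : ℝ) < 2 ^ l := by positivity
  refine le_of_mul_le_mul_left ?_ h3
  linarith

/-- Beyond the benchmark index, exceeding the threshold has small probability. -/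
lemma measureReal_exceed_le (hn : 0 < n) (hf : ConvexOn ℝ (Set.Icc (-1 / 2 : ℝ) (1 / 2)) f)
    (hY : IsWhiteNoiseObservation Y f n P) (h : (oracleSet n α Y P).Nonempty) (l : ℕ) :
    P.real {ω | z α * sigma n (jStar n α Y P + l) < T (fun t => Y t ω) (jStar n α Y P + l)} ≤
      gaussianTail ((1 - 2 / 3 / (2 * √2) ^ l) * z α) := by
  obtain ⟨h1, h2⟩ := jStar_mem h
  set J := jStar n α Y P
  rw [measureReal_lt_T hn hY (by omega)]
  refine strictAnti_gaussianTail.antitone ?_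
  have hs := sigma_pos hn J
  have hs' := sigma_pos hn (J + l)
  rw [le_div_iff₀ hs']
  have h3 := (integral_T_add_le hn hf hY h1 l).trans h2
  have h4 : ∫ ω, T (fun t => Y t ω) (J + l) ∂P ≤ 2 / 3 * z α * sigma n J / 2 ^ l := by
    rw [le_div_iff₀ (by positivity)]; linarith
  -- The halving of the mean and the √2 growth of `sigma` combine into (2√2)^l.
  have h5 : 2 / 3 / (2 * √2) ^ l * z α * sigma n (J + l) = 2 / 3 * z α * sigma n J / 2 ^ l := by
    rw [sigma_add, mul_pow]
    field_simp
  linarith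

/-- Well below the benchmark index, selection has small probability. -/
lemma measureReal_select_le (hn : 0 < n) (hf : ConvexOn ℝ (Set.Icc (-1 / 2 : ℝ) (1 / 2)) f)
    (hY : IsWhiteNoiseObservation Y f n P) (hz : 0 < z α) {j l : ℕ} (hj : 1 ≤ j)
    (hjl : j + (l + 3) = jStar n α Y P) :
    P.real {ω | T (fun t => Y t ω) j ≤ z α * sigma n j} ≤ gaussianTail (2 ^ (l + 2) * z α) := by
  rw [measureReal_T_le hn hY hj]
  refine strictAnti_gaussianTail.antitone ?_
  have hs := sigma_pos hn j
  rw [le_div_iff₀ hs]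
  -- Level J - 1 fails the benchmark condition by minimality. Going back l + 2 levels multiplies its
  -- mean at least by 2^(l+2), and √2^(l+2) ≥ 2 leaves (4/3) · 2^(l+2) - 1 ≥ 2^(l+2) standard
  -- deviations, in units of `z α`.
  have hnot : j + (l + 2) ∉ oracleSet n α Y P :=
    Nat.notMem_of_lt_sInf (by rw [jStar] at hjl; omega)
  have h1 : 2 / 3 * z α * sigma n (j + (l + 2)) < ∫ ω, T (fun t => Y t ω) (j + (l + 2)) ∂P := by
    by_contra hcon
    exact hnot ⟨by omega, not_lt.1 hcon⟩
  have h2 := integral_T_add_le hn hf hY hj (l + 2)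
  have h3 : (2 : ℝ) ≤ √2 ^ (l + 2) := by
    have : √2 ^ 2 = 2 := Real.sq_sqrt (by norm_num)
    have h1 : (1 : ℝ) ≤ √2 := Real.le_sqrt_of_sq_le (by norm_num)
    rw [pow_add, this]
    linarith [one_le_pow₀ (n := l) h1]
  have h4 : (4 : ℝ) ≤ 2 ^ (l + 2) := by
    rw [pow_add]
    linarith [one_le_pow₀ (n := l) (one_le_two : (1 : ℝ) ≤ 2)]
  rw [sigma_add] at h1
  have hzs : 0 < z α * sigma n j := mul_pos hz hs
  have h5 := mul_le_mul_of_nonneg_left h1.le (by positivity : (0 : ℝ) ≤ 2 ^ (l + 2))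
  have h6 : (2 : ℝ) ^ (l + 2) * (2 / 3 * 2 * (z α * sigma n j)) ≤
      2 ^ (l + 2) * (2 / 3 * z α * (√2 ^ (l + 2) * sigma n j)) := by
    have := mul_le_mul_of_nonneg_right h3 hzs.le
    refine mul_le_mul_of_nonneg_left ?_ (by positivity)
    linarith
  have h7 := mul_le_mul_of_nonneg_right h4 hzs.le
  linarith

lemma measureReal_exceedEvent (hn : 0 < n) (hY : IsWhiteNoiseObservation Y f n P) {J : ℕ}
    (hJ : 1 ≤ J) (N : ℕ) : P.real (exceedEvent n α Y J N) =
      ∏ l ∈ Finset.range N, P.real {ω | z α * sigma n (J + l) < T (fun t => Y t ω) (J + l)} := by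
  obtain ⟨k, rfl⟩ := Nat.exists_eq_add_of_le' hJ
  have hind : iIndepFun (fun l ω => T (fun t => Y t ω) (k + 1 + l)) P := by
    have := (iIndepFun_T hn hY).precomp (g := fun l => k + l) (add_right_injective k)
    convert! this using 3
    ring_nf
  have := hind.measure_inter_preimage_eq_mul (Finset.range N)
    (sets := fun l => Set.Ioi (z α * sigma n (k + 1 + l))) (fun _ _ => measurableSet_Ioi)
  have h2 := congrArg ENNReal.toReal this
  rw [ENNReal.toReal_prod] at h2
  exact h2

lemma measureReal_exceedEvent_three_le (hn : 0 < n)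
    (hf : ConvexOn ℝ (Set.Icc (-1 / 2 : ℝ) (1 / 2)) f) (hY : IsWhiteNoiseObservation Y f n P)
    (hα : 0 < α) (hα' : α ≤ 0.2) (h : (oracleSet n α Y P).Nonempty) :
    P.real (exceedEvent n α Y (jStar n α Y P) 3) ≤ (1 / 6 - 1 / 50) * α := by
  have hz := z_lower_bound hα hα'
  have hb := measureReal_exceed_le hn hf hY h
  have hpr := gaussianTail_triple_product_le (y := z α) (by linarith)
  rw [gaussianTail_z hα (by norm_num at hα'; linarith)] at hpr
  rw [measureReal_exceedEvent hn hY (jStar_mem h).1]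
  refine le_trans (Finset.prod_le_prod (fun _ _ => measureReal_nonneg) (fun l _ => hb l)) ?_
  rw [Finset.prod_range_succ, Finset.prod_range_succ, Finset.prod_range_one]
  refine le_trans (le_of_eq ?_) hpr
  have h2 : √2 ^ 2 = 2 := Real.sq_sqrt (by norm_num)
  have e1 : (2 : ℝ) / 3 / (2 * √2) ^ 1 = √2 / 6 := by
    field_simp
    rw [h2]; norm_num
  have e2 : (2 : ℝ) / 3 / (2 * √2) ^ 2 = 1 / 12 := by
    rw [mul_pow, h2]; norm_num
  rw [e1, e2]
  norm_num
  left; left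
  congr 1
  ring

/-- From the third level on the relative threshold is at least 11/12, hence the geometric rate
0.222. It serves both the existence of the selected index and the length series, where √2 · 0.222 <
1. -/
lemma measureReal_exceedEvent_succ_le (hn : 0 < n)
    (hf : ConvexOn ℝ (Set.Icc (-1 / 2 : ℝ) (1 / 2)) f) (hY : IsWhiteNoiseObservation Y f n P)
    (hα : 0 < α) (hα' : α ≤ 0.2) (h : (oracleSet n α Y P).Nonempty) :
    P.real (exceedEvent n α Y (jStar n α Y P) 1) ≤ 0.39 ∧ ∀ N : ℕ,
    P.real (exceedEvent n α Y (jStar n α Y P) (N + 2)) ≤ 0.39 * 0.261 * 0.222 ^ N := by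
  have hz := z_lower_bound hα hα'
  have hz' : 0.84 ≤ z α := by linarith
  have hb := measureReal_exceed_le hn hf hY h
  have h2 : √2 ^ 2 = 2 := Real.sq_sqrt (by norm_num)
  have b0 : gaussianTail ((1 - 2 / 3 / (2 * √2) ^ 0) * z α) ≤ 0.39 := by
    refine le_trans (le_of_eq ?_) (gaussianTail_div_three_le hz')
    norm_num
    congr 1
    ring
  have b1 : gaussianTail ((1 - 2 / 3 / (2 * √2) ^ 1) * z α) ≤ 0.261 := by
    refine le_trans (le_of_eq ?_) (gaussianTail_second_le hz')
    have e1 : (2 : ℝ) / 3 / (2 * √2) ^ 1 = √2 / 6 := by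
      field_simp
      rw [h2]; norm_num
    rw [e1]
  have b2 : ∀ l, gaussianTail ((1 - 2 / 3 / (2 * √2) ^ (l + 2)) * z α) ≤ 0.222 := by
    intro l
    refine le_trans (strictAnti_gaussianTail.antitone ?_) (gaussianTail_third_le hz')
    have h8 : (8 : ℝ) ≤ (2 * √2) ^ (l + 2) := by
      have h1 : (1 : ℝ) ≤ 2 * √2 := by
        have : (1 : ℝ) ≤ √2 := Real.le_sqrt_of_sq_le (by norm_num)
        linarith
      rw [pow_add, mul_pow _ _ 2, h2]
      linarith [one_le_pow₀ (n := l) h1]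
    have : (2 : ℝ) / 3 / (2 * √2) ^ (l + 2) ≤ 1 / 12 := by
      rw [div_le_iff₀ (by positivity)]; linarith
    exact mul_le_mul_of_nonneg_right (by linarith) (by linarith)
  constructor
  · rw [measureReal_exceedEvent hn hY (jStar_mem h).1, Finset.prod_range_one]
    exact (hb 0).trans b0
  · intro N
    induction N with
    | zero =>
      rw [measureReal_exceedEvent hn hY (jStar_mem h).1, Finset.prod_range_succ,
        Finset.prod_range_one, pow_zero, mul_one]
      exact mul_le_mul ((hb 0).trans b0) ((hb 1).trans b1) measureReal_nonneg (by norm_num)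
    | succ N ih =>
      rw [measureReal_exceedEvent hn hY (jStar_mem h).1] at ih ⊢
      rw [Finset.prod_range_succ, pow_succ, ← mul_assoc]
      exact mul_le_mul ih ((hb (N + 2)).trans (b2 N)) measureReal_nonneg (by positivity)

/-- The selected index is almost surely well defined. -/
lemma ae_selectable_nonempty (hn : 0 < n) (hf : ConvexOn ℝ (Set.Icc (-1 / 2 : ℝ) (1 / 2)) f)
    (hY : IsWhiteNoiseObservation Y f n P) (hα : 0 < α) (hα' : α ≤ 0.2)
    (h : (oracleSet n α Y P).Nonempty) :
    ∀ᵐ ω ∂P, (selectable n α (fun t => Y t ω)).Nonempty := by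
  have hsub : ∀ N, {ω | ¬ (selectable n α (fun t => Y t ω)).Nonempty} ⊆
      exceedEvent n α Y (jStar n α Y P) (N + 2) := by
    intro N ω hω
    simp only [exceedEvent, Set.mem_iInter, Finset.mem_range]
    intro l hl
    by_contra hcon
    exact hω ⟨jStar n α Y P + l, le_add_right (jStar_mem h).1, not_lt.1 hcon⟩
  have hlim : Filter.Tendsto (fun N : ℕ => (0.39 * 0.261 * 0.222 ^ N : ℝ)) Filter.atTop
      (nhds (0.39 * 0.261 * 0)) :=
    (tendsto_pow_atTop_nhds_zero_of_lt_one (by norm_num) (by norm_num)).const_mul _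
  rw [mul_zero] at hlim
  have h0 : P.real {ω | ¬ (selectable n α (fun t => Y t ω)).Nonempty} ≤ 0 :=
    ge_of_tendsto' hlim fun N => (measureReal_mono (hsub N)).trans
      ((measureReal_exceedEvent_succ_le hn hf hY hα hα' h).2 N)
  rw [ae_iff]
  exact (measureReal_eq_zero_iff).1 (le_antisymm h0 measureReal_nonneg)

end

/-- Telescopes `sigma` from J to the selected level; the step from J + N to J + N + 1 is paid only
if the first N + 1 levels all exceed. -/
lemma sigma_jHat_le {Ω : Type*} {Y : ℝ → Ω → ℝ} {n α : ℝ} (hn : 0 < n) {J : ℕ}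
    (hJ : 1 ≤ J) (ω : Ω) :
    ENNReal.ofReal (sigma n (jHat n α (fun t => Y t ω))) ≤ ENNReal.ofReal (sigma n J) +
      ∑' N, (exceedEvent n α Y J (N + 1)).indicator
        (fun _ => ENNReal.ofReal ((√2 - 1) * √2 ^ N * sigma n J)) ω := by
  -- The first case also covers the default value 0 when no level is selectable, so the bound holds
  -- for every ω.
  obtain hle | hlt := le_or_gt (jHat n α (fun t => Y t ω)) J
  · exact (ENNReal.ofReal_le_ofReal (sigma_mono hn hle)).trans le_self_add
  obtain ⟨M, hM⟩ := Nat.exists_eq_add_of_le hlt.le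
  have h1 : (0 : ℝ) ≤ √2 - 1 := sub_nonneg.2 (Real.le_sqrt_of_sq_le (by norm_num))
  have hs := sigma_pos hn J
  have htel : sigma n (J + M) = sigma n J +
      ∑ N ∈ Finset.range M, (√2 - 1) * √2 ^ N * sigma n J := by
    rw [sigma_add, ← Finset.sum_mul, ← Finset.mul_sum, mul_geom_sum]
    ring
  rw [hM, htel, ENNReal.ofReal_add hs.le (Finset.sum_nonneg fun _ _ => by positivity),
    ENNReal.ofReal_sum_of_nonneg fun _ _ => by positivity]
  gcongr
  refine le_trans (le_of_eq (Finset.sum_congr rfl fun N hN => ?_)) (ENNReal.sum_le_tsum _)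
  rw [Set.indicator_of_mem]
  refine mem_exceedEvent_of_le_jHat hJ ?_
  have := Finset.mem_range.1 hN
  omega

/-! ### Coverage -/

section

variable {Ω : Type*} [MeasurableSpace Ω] {P : Measure Ω} [IsProbabilityMeasure P]
  {Y : ℝ → Ω → ℝ} {f : ℝ → ℝ} {n : ℝ} {α : ℝ}

lemma measureReal_early_selection_le (hn : 0 < n)
    (hf : ConvexOn ℝ (Set.Icc (-1 / 2 : ℝ) (1 / 2)) f) (hY : IsWhiteNoiseObservation Y f n P)
    (hα : 0 < α) (hα' : α ≤ 0.2) :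
    P.real (⋃ i ∈ Finset.range (jStar n α Y P - 3),
      {ω | T (fun t => Y t ω) (jStar n α Y P - 3 - i) ≤
        z α * sigma n (jStar n α Y P - 3 - i)}) ≤ α / 50 := by
  have hz := z_lower_bound hα hα'
  have hα1 : α < 1 := by norm_num at hα'; linarith
  set J := jStar n α Y P with hJ
  refine (measureReal_biUnion_finset_le _ _).trans ?_
  calc ∑ i ∈ Finset.range (J - 3),
        P.real {ω | T (fun t => Y t ω) (J - 3 - i) ≤ z α * sigma n (J - 3 - i)}
      ≤ ∑ i ∈ Finset.range (J - 3), α / 100 * (1 / 2) ^ i := by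
        refine Finset.sum_le_sum fun i hi => ?_
        rw [Finset.mem_range] at hi
        have h1 := measureReal_select_le hn hf hY (α := α) (by linarith) (j := J - 3 - i) (l := i)
          (by omega) (by omega)
        have h2 := gaussianTail_two_pow_mul_le (y := z α) (by linarith) i
        rw [gaussianTail_z hα hα1] at h2
        exact h1.trans h2
    _ = α / 100 * ∑ i ∈ Finset.range (J - 3), (1 / 2) ^ i := by rw [Finset.mul_sum]
    _ ≤ α / 100 * 2 := by
        gcongr
        have := Summable.sum_le_tsum (Finset.range (J - 3))
          (fun i _ => by positivity : ∀ i ∉ Finset.range (J - 3), (0 : ℝ) ≤ (1 / 2) ^ i)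
          summable_geometric_two
        rwa [tsum_geometric_two] at this
    _ = α / 50 := by ring

/-- The adaptive interval covers `f 0` with probability at least `1 - α`. -/
lemma coverage_CIStar (hn : 0 < n) (hf : ConvexOn ℝ (Set.Icc (-1 / 2 : ℝ) (1 / 2)) f)
    (hY : IsWhiteNoiseObservation Y f n P) (hα : 0 < α) (hα' : α ≤ 0.2)
    (h : (oracleSet n α Y P).Nonempty) :
    1 - α ≤ P.real {ω | f 0 ∈ CIStar n α (fun t => Y t ω)} := by
  have hα1 : α < 1 := by norm_num at hα'; linarith
  obtain ⟨hJ1, -⟩ := jStar_mem h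
  have hearly := measureReal_early_selection_le hn hf hY hα hα'
  have hlate := measureReal_exceedEvent_three_le hn hf hY hα hα' h
  have hne := ae_selectable_nonempty hn hf hY hα hα' h
  set J := jStar n α Y P with hJ
  -- The filter removes level 0, which truncated subtraction admits when J ≤ 2.
  set S := (Finset.Icc (J - 2) (J + 2)).filter (1 ≤ ·) with hS
  have hmid : P.real (⋃ j ∈ S, {ω | f 0 ∉ CI n (α / 6) (fun t => Y t ω) j}) ≤ 5 * (α / 6) := by
    refine (measureReal_biUnion_finset_le _ _).trans ?_
    refine (Finset.sum_le_card_nsmul S _ (α / 6) fun j hj => ?_).trans ?_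
    · obtain ⟨k, rfl⟩ := Nat.exists_eq_add_of_le' (Finset.mem_filter.1 hj).2
      exact measureReal_notMem_CI_le hn hf hY (by linarith) (by linarith) k
    · have hcard : S.card ≤ 5 := by
        refine (Finset.card_filter_le _ _).trans ?_
        rw [Nat.card_Icc]; omega
      rw [nsmul_eq_mul]
      have : (S.card : ℝ) ≤ 5 := by exact_mod_cast hcard
      gcongr
  set A := {ω | f 0 ∈ CIStar n α (fun t => Y t ω)} with hA
  set U := (⋃ j ∈ S, {ω | f 0 ∉ CI n (α / 6) (fun t => Y t ω) j}) ∪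
    (exceedEvent n α Y J 3 ∪ ⋃ i ∈ Finset.range (J - 3),
      {ω | T (fun t => Y t ω) (J - 3 - i) ≤ z α * sigma n (J - 3 - i)}) with hU
  -- Covering the whole space bounds P(A) from below by subadditivity, without measurability of A.
  have hsub : (Set.univ : Set Ω) ≤ᵐ[P] (A ∪ U : Set Ω) := by
    filter_upwards [hne] with ω hω _
    by_cases hmem : f 0 ∈ CIStar n α (fun t => Y t ω)
    · exact Or.inl hmem
    right
    have hsel : jHat n α (fun t => Y t ω) ∈ selectable n α (fun t => Y t ω) := Nat.sInf_mem hω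
    rw [CIStar] at hmem
    obtain hge | hlt := le_or_gt (J + 3) (jHat n α (fun t => Y t ω))
    · exact Or.inr (Or.inl (mem_exceedEvent_of_le_jHat hJ1 hge))
    obtain hle | hgt := le_or_gt (jHat n α (fun t => Y t ω) + 3) J
    · right; right
      refine Set.mem_biUnion (x := J - 3 - jHat n α (fun t => Y t ω)) ?_ ?_
      · have := hsel.1
        simp only [Finset.coe_range, Set.mem_Iio]
        omega
      · have e : J - 3 - (J - 3 - jHat n α (fun t => Y t ω)) = jHat n α (fun t => Y t ω) := by
          omega
        show T (fun t => Y t ω) _ ≤ z α * sigma n _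
        rw [e]
        exact hsel.2
    · left
      refine Set.mem_biUnion (x := jHat n α (fun t => Y t ω)) ?_ hmem
      simp only [hS, Finset.coe_filter, Finset.mem_Icc]
      exact ⟨⟨by omega, by omega⟩, hsel.1⟩
  have h1 : (1 : ℝ) ≤ P.real A + P.real U := by
    have : P.real Set.univ ≤ P.real (A ∪ U) :=
      ENNReal.toReal_mono (measure_ne_top _ _) (measure_mono_ae hsub)
    rw [probReal_univ] at this
    exact this.trans (measureReal_union_le _ _)
  have h2 : P.real U ≤ 5 * (α / 6) + ((1 / 6 - 1 / 50) * α + α / 50) :=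
    (measureReal_union_le _ _).trans
      (add_le_add hmid ((measureReal_union_le _ _).trans (add_le_add hlate hearly)))
  linarith

/-! ### Expected length -/

lemma length_CI (n a : ℝ) (y : ℝ → ℝ) (j : ℕ) : length (CI n a y j) =
    max (T y j + z (a / 2) * (√5 + √2) * sigma n j) 0 := by
  rw [length, CI, Real.volume_real_Icc, T, sigma_add_one]
  ring_nf

lemma nullMeasurableSet_lt_T (hn : 0 < n) (hY : IsWhiteNoiseObservation Y f n P) {j : ℕ}
    (hj : 1 ≤ j) (c : ℝ) : NullMeasurableSet {ω | c < T (fun t => Y t ω) j} P := by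
  obtain ⟨k, rfl⟩ := Nat.exists_eq_add_of_le' hj
  exact nullMeasurableSet_lt aemeasurable_const (T_mean_variance hn hY k).1.aemeasurable

lemma nullMeasurableSet_exceedEvent (hn : 0 < n) (hY : IsWhiteNoiseObservation Y f n P) {J : ℕ}
    (hJ : 1 ≤ J) (N : ℕ) : NullMeasurableSet (exceedEvent n α Y J N) P :=
  Finset.nullMeasurableSet_biInter _ fun l _ => nullMeasurableSet_lt_T hn hY (by omega) _

lemma nullMeasurableSet_jHat_eq (hn : 0 < n) (hY : IsWhiteNoiseObservation Y f n P) (k : ℕ) :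
    NullMeasurableSet {ω | jHat n α (fun t => Y t ω) = k + 1} P := by
  have : {ω | jHat n α (fun t => Y t ω) = k + 1} = exceedEvent n α Y 1 k ∩
      {ω | z α * sigma n (k + 1) < T (fun t => Y t ω) (k + 1)}ᶜ := by
    ext ω
    constructor
    · intro hω
      have hω' : jHat n α (fun t => Y t ω) = k + 1 := hω
      refine ⟨mem_exceedEvent_of_le_jHat le_rfl (by omega), ?_⟩
      -- An empty set has infimum 0, which cannot equal k + 1.
      have hne : (selectable n α (fun t => Y t ω)).Nonempty := by
        by_contra hcon
        rw [Set.not_nonempty_iff_eq_empty] at hcon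
        rw [jHat, hcon, Nat.sInf_empty] at hω'
        omega
      have := Nat.sInf_mem hne
      rw [← jHat, hω'] at this
      exact not_lt.2 this.2
    · rintro ⟨h1, h2⟩
      have hsel : k + 1 ∈ selectable n α (fun t => Y t ω) := ⟨by omega, not_lt.1 h2⟩
      refine le_antisymm (Nat.sInf_le hsel) ?_
      refine le_csInf ⟨_, hsel⟩ fun j hj => ?_
      by_contra hlt
      simp only [exceedEvent, Set.mem_iInter, Finset.mem_range] at h1
      have h3 : z α * sigma n (1 + (j - 1)) < T (fun t => Y t ω) (1 + (j - 1)) :=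
        h1 (j - 1) (by have := hj.1; omega)
      rw [Nat.add_sub_cancel' hj.1] at h3
      exact absurd hj.2 (not_le.2 h3)
  rw [this]
  exact (nullMeasurableSet_exceedEvent hn hY le_rfl k).inter
    (nullMeasurableSet_lt_T hn hY (by omega) _).compl

/-- The length is split by the value of the selected index; almost surely the partial sums are
eventually constant. -/
lemma aemeasurable_length_CIStar (hn : 0 < n)
    (hY : IsWhiteNoiseObservation Y f n P)
    (hne : ∀ᵐ ω ∂P, (selectable n α (fun t => Y t ω)).Nonempty) :
    AEMeasurable (fun ω => length (CIStar n α (fun t => Y t ω))) P := by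
  refine aemeasurable_of_tendsto_metrizable_ae Filter.atTop
    (f := fun N ω => ∑ k ∈ Finset.range N, {ω | jHat n α (fun t => Y t ω) = k + 1}.indicator
      (fun ω => length (CI n (α / 6) (fun t => Y t ω) (k + 1))) ω) (fun N => ?_) ?_
  · refine Finset.aemeasurable_fun_sum _ fun k _ => ?_
    refine AEMeasurable.indicator₀ ?_ (nullMeasurableSet_jHat_eq hn hY k)
    simp_rw [length_CI]
    exact ((T_mean_variance hn hY k).1.aemeasurable.add_const _).max aemeasurable_const
  · filter_upwards [hne] with ω hω
    have hsel := Nat.sInf_mem hω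
    obtain ⟨k, hk⟩ := Nat.exists_eq_add_of_le' hsel.1
    have hk' : jHat n α (fun t => Y t ω) = k + 1 := hk
    refine tendsto_atTop_of_eventually_const (i₀ := k + 1) fun N hN => ?_
    rw [Finset.sum_eq_single_of_mem k (Finset.mem_range.2 (by omega))]
    · rw [Set.indicator_of_mem (by exact hk'), CIStar, hk']
    · intro i _ hik
      refine Set.indicator_of_notMem (fun hmem => hik ?_) _
      have : jHat n α (fun t => Y t ω) = i + 1 := hmem
      omega

lemma length_CIStar_le (hn : 0 < n) (hα : 0 < α) (hα' : α ≤ 0.2) {y : ℝ → ℝ}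
    (hy : (selectable n α y).Nonempty) :
    length (CIStar n α y) ≤ (z α + (√5 + √2) * z (α / 12)) * sigma n (jHat n α y) := by
  have hsel : jHat n α y ∈ selectable n α y := Nat.sInf_mem hy
  have hz := z_lower_bound hα hα'
  have hz' := z_lower_bound (a := α / 12) (by linarith) (by norm_num at hα' ⊢; linarith)
  have hs := sigma_pos hn (jHat n α y)
  rw [CIStar, length_CI, show α / 6 / 2 = α / 12 by ring]
  have h1 : 0 < z α := by linarith
  have h2 : 0 < z (α / 12) := by linarith
  refine max_le ?_ (by positivity)
  have := hsel.2
  linarith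

lemma lintegral_sigma_jHat_le (hn : 0 < n) (hf : ConvexOn ℝ (Set.Icc (-1 / 2 : ℝ) (1 / 2)) f)
    (hY : IsWhiteNoiseObservation Y f n P) (hα : 0 < α) (hα' : α ≤ 0.2)
    (h : (oracleSet n α Y P).Nonempty) :
    ∫⁻ ω, ENNReal.ofReal (sigma n (jHat n α (fun t => Y t ω))) ∂P ≤
      ENNReal.ofReal (1.25 * sigma n (jStar n α Y P)) := by
  obtain ⟨hJ1, -⟩ := jStar_mem h
  obtain ⟨hE1, hE2⟩ := measureReal_exceedEvent_succ_le hn hf hY hα hα' h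
  set J := jStar n α Y P with hJ
  have hs := sigma_pos hn J
  have h1 : (0 : ℝ) ≤ √2 - 1 := sub_nonneg.2 (Real.le_sqrt_of_sq_le (by norm_num))
  have h2 : √2 ≤ 1.41422 := Real.sqrt_le_iff.2 ⟨by norm_num, by norm_num⟩
  have hE := fun N => nullMeasurableSet_exceedEvent (α := α) hn hY hJ1 N
  have hterm : ∀ N, ∫⁻ ω, (exceedEvent n α Y J (N + 1)).indicator
      (fun _ => ENNReal.ofReal ((√2 - 1) * √2 ^ N * sigma n J)) ω ∂P =
      ENNReal.ofReal ((√2 - 1) * √2 ^ N * sigma n J * P.real (exceedEvent n α Y J (N + 1))) := by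
    intro N
    rw [lintegral_indicator_const₀ (hE _),
      ENNReal.ofReal_mul (p := (√2 - 1) * √2 ^ N * sigma n J) (by positivity), ofReal_measureReal]
  calc _ ≤ ∫⁻ ω, (ENNReal.ofReal (sigma n J) +
      ∑' N, (exceedEvent n α Y J (N + 1)).indicator
        (fun _ => ENNReal.ofReal ((√2 - 1) * √2 ^ N * sigma n J)) ω) ∂P :=
        lintegral_mono fun ω => sigma_jHat_le hn hJ1 ω
    _ = ENNReal.ofReal (sigma n J) + ∑' N, ENNReal.ofReal
        ((√2 - 1) * √2 ^ N * sigma n J * P.real (exceedEvent n α Y J (N + 1))) := by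
        rw [lintegral_add_left measurable_const, lintegral_const, measure_univ, mul_one,
          lintegral_tsum fun N => aemeasurable_const.indicator₀ (hE _)]
        simp_rw [hterm]
    -- The N = 0 term contributes about 0.162; the rest is geometric with ratio √2 · 0.222 < 0.314
    -- and contributes about 0.087.
    _ ≤ ENNReal.ofReal (sigma n J) + ENNReal.ofReal (0.25 * sigma n J) := by
        gcongr
        refine ENNReal.tsum_le_of_sum_range_le fun M => ?_
        rw [← ENNReal.ofReal_sum_of_nonneg fun N _ => by positivity]
        refine ENNReal.ofReal_le_ofReal ?_
        cases M with
        | zero => simp; positivity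
        | succ M =>
          rw [Finset.sum_range_succ']
          have hfirst : (√2 - 1) * √2 ^ 0 * sigma n J * P.real (exceedEvent n α Y J (0 + 1)) ≤
              0.41422 * 0.39 * sigma n J := by
            have := mul_le_mul (by linarith : √2 - 1 ≤ 0.41422) hE1 measureReal_nonneg
              (by norm_num)
            have := mul_le_mul_of_nonneg_right this hs.le
            simp only [pow_zero, zero_add]
            linarith
          have hrest : ∑ N ∈ Finset.range M, (√2 - 1) * √2 ^ (N + 1) * sigma n J *
              P.real (exceedEvent n α Y J (N + 1 + 1)) ≤
              0.41422 * 1.41422 * (0.39 * 0.261) * sigma n J * (1 - 0.314)⁻¹ := by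
            calc _ ≤ ∑ N ∈ Finset.range M, 0.41422 * 1.41422 * (0.39 * 0.261) * sigma n J *
                  (0.314 : ℝ) ^ N := by
                  refine Finset.sum_le_sum fun N _ => ?_
                  have e1 : √2 - 1 ≤ 0.41422 := by linarith
                  calc _ ≤ 0.41422 * 1.41422 ^ (N + 1) * sigma n J *
                        (0.39 * 0.261 * 0.222 ^ N) := by
                        gcongr
                        exact hE2 N
                    _ = 0.41422 * 1.41422 * (0.39 * 0.261) * sigma n J *
                        (1.41422 * 0.222) ^ N := by rw [mul_pow]; ring
                    _ ≤ _ := by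
                        gcongr
                        norm_num
              _ = 0.41422 * 1.41422 * (0.39 * 0.261) * sigma n J *
                  ∑ N ∈ Finset.range M, (0.314 : ℝ) ^ N := by rw [Finset.mul_sum]
              _ ≤ _ := by
                  gcongr
                  have := Summable.sum_le_tsum (Finset.range M)
                    (fun i _ => by positivity : ∀ i ∉ Finset.range M, (0 : ℝ) ≤ 0.314 ^ i)
                    (summable_geometric_of_lt_one (by norm_num) (by norm_num))
                  rwa [tsum_geometric_of_lt_one (by norm_num) (by norm_num)] at this
          refine (add_le_add hrest hfirst).trans ?_
          norm_num
          linarith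
    _ = ENNReal.ofReal (1.25 * sigma n J) := by
        rw [← ENNReal.ofReal_add hs.le (by positivity)]
        ring_nf

/-- The expected length of the adaptive interval is finite and of the order of the benchmark. -/
lemma expected_length_CIStar (hn : 0 < n) (hf : ConvexOn ℝ (Set.Icc (-1 / 2 : ℝ) (1 / 2)) f)
    (hY : IsWhiteNoiseObservation Y f n P) (hα : 0 < α) (hα' : α ≤ 0.2)
    (h : (oracleSet n α Y P).Nonempty) :
    Integrable (fun ω => length (CIStar n α (fun t => Y t ω))) P ∧
    ∫ ω, length (CIStar n α (fun t => Y t ω)) ∂P ≤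
      1.25 * (z α + (√5 + √2) * z (α / 12)) * sigma n (jStar n α Y P) := by
  have hne := ae_selectable_nonempty hn hf hY hα hα' h
  have hz := z_lower_bound hα hα'
  have hz' := z_lower_bound (a := α / 12) (by linarith) (by norm_num at hα' ⊢; linarith)
  have hs := sigma_pos hn (jStar n α Y P)
  set c := z α + (√5 + √2) * z (α / 12) with hc
  have hc0 : 0 ≤ c := by
    have h1 : 0 < z α := by linarith
    have h2 : 0 < z (α / 12) := by linarith
    positivity
  have hmeas := (aemeasurable_length_CIStar hn hY hne).aestronglyMeasurable
  have hnn : ∀ ω, 0 ≤ length (CIStar n α (fun t => Y t ω)) := fun ω => measureReal_nonneg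
  -- One bound on the lower integral yields both integrability and the estimate of the expectation.
  have hbound : ∫⁻ ω, ENNReal.ofReal (length (CIStar n α (fun t => Y t ω))) ∂P ≤
      ENNReal.ofReal (1.25 * c * sigma n (jStar n α Y P)) := by
    calc _ ≤ ∫⁻ ω, ENNReal.ofReal c *
          ENNReal.ofReal (sigma n (jHat n α (fun t => Y t ω))) ∂P := by
          refine lintegral_mono_ae ?_
          filter_upwards [hne] with ω hω
          rw [← ENNReal.ofReal_mul hc0]
          exact ENNReal.ofReal_le_ofReal (length_CIStar_le hn hα hα' hω)
      _ = ENNReal.ofReal c * ∫⁻ ω, ENNReal.ofReal (sigma n (jHat n α (fun t => Y t ω))) ∂P :=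
          lintegral_const_mul' _ _ ENNReal.ofReal_ne_top
      _ ≤ ENNReal.ofReal c * ENNReal.ofReal (1.25 * sigma n (jStar n α Y P)) := by
          gcongr
          exact lintegral_sigma_jHat_le hn hf hY hα hα' h
      _ = _ := by
          rw [← ENNReal.ofReal_mul hc0]
          ring_nf
  constructor
  · refine ⟨hmeas, ?_⟩
    rw [hasFiniteIntegral_iff_ofReal (Filter.Eventually.of_forall hnn)]
    exact hbound.trans_lt ENNReal.ofReal_lt_top
  · rw [integral_eq_lintegral_of_nonneg_ae (Filter.Eventually.of_forall hnn) hmeas]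
    exact ENNReal.toReal_le_of_le_ofReal (by positivity) hbound

end

end ConvexCI

theorem theorem4
    (α : ℝ) (hα : 0 < α) (hα' : α ≤ 0.2) (n : ℝ) (hn : 0 < n)
    (f : ℝ → ℝ) (hf : ConvexOn ℝ (Set.Icc (-1 / 2 : ℝ) (1 / 2)) f)
    {Ω : Type*} [MeasurableSpace Ω] (P : Measure Ω) [IsProbabilityMeasure P]
    (Y : ℝ → Ω → ℝ) (hY : ConvexCI.IsWhiteNoiseObservation Y f n P) :
    -- the indices `ĵ` (almost surely) and `j_*^c` are well defined
    (∀ᵐ ω ∂P, (ConvexCI.selectable n α (fun t => Y t ω)).Nonempty) ∧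
    (∀ j : ℕ, 1 ≤ j → Integrable (fun ω => ConvexCI.T (fun t => Y t ω) j) P) ∧
    (ConvexCI.oracleSet n α Y P).Nonempty ∧
    -- coverage probability
    1 - α ≤ P.real {ω | f 0 ∈ ConvexCI.CIStar n α (fun t => Y t ω)} ∧
    -- expected length
    Integrable (fun ω => ConvexCI.length (ConvexCI.CIStar n α (fun t => Y t ω))) P ∧
    ∫ ω, ConvexCI.length (ConvexCI.CIStar n α (fun t => Y t ω)) ∂P ≤
      1.25 * (ConvexCI.z α + (Real.sqrt 5 + Real.sqrt 2) * ConvexCI.z (α / 12)) *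
        ConvexCI.sigma n (ConvexCI.jStar n α Y P) ∧
    1.25 * (ConvexCI.z α + (Real.sqrt 5 + Real.sqrt 2) * ConvexCI.z (α / 12)) *
        ConvexCI.sigma n (ConvexCI.jStar n α Y P) ≤
      12.79 * ConvexCI.z α * ConvexCI.sigma n (ConvexCI.jStar n α Y P) := by
  have hz := ConvexCI.z_lower_bound hα hα'
  have hor := ConvexCI.oracleSet_nonempty (α := α) hn hf hY (by linarith)
  have hlen := ConvexCI.expected_length_CIStar hn hf hY hα hα' hor
  refine ⟨ConvexCI.ae_selectable_nonempty hn hf hY hα hα' hor, fun j hj => ?_, hor,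
    ConvexCI.coverage_CIStar hn hf hY hα hα' hor, hlen.1, hlen.2, ?_⟩
  · obtain ⟨k, rfl⟩ := Nat.exists_eq_add_of_le' hj
    exact (ConvexCI.T_mean_variance hn hY k).1.integrable
  · refine mul_le_mul_of_nonneg_right ?_ (ConvexCI.sigma_pos hn _).le
    have := ConvexCI.z_div_twelve_le hα hα'
    norm_num at this ⊢
    linarith
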